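/- Let $e^{t\Delta}$ be the heat semigroup on $\mathbb{R}^2$, $\Lambda=(-\Delta)^{1/2}$ and $\nabla^\perp=(-\partial_{x_2},\partial_{x_1})$. Consider the two-dimensional dissipative surface quasi-geostrophic equation $$\partial_t\theta+u\cdot\nabla\theta-\Delta\theta=0,\qquad u=\nabla^\perp\Lambda^{-1}\theta\qquad\text{in }(0,T)\times\mathbb{R}^2,\qquad \theta(0,\cdot)=\theta_0\in L^2(\mathbb{R}^2).$$ Here $\nabla^\perp\Lambda^{-1}$ is the Fourier multiplier on $L^2(\mathbb{R}^2)$ with symbol $i(-\xi_2,\xi_1)/|\xi|$. A real-valued function $\theta\in C([0,T];L^2(\mathbb{R}^2))$ is called a mild solution with initial datum $\theta_0\in L^2(\mathbb{R}^2)$ if $$\theta(t)=e^{t\Delta}\theta_0-\int_0^t\nabla\cdot e^{(t-s)\Delta}\bigl(u(s)\theta(s)\bigr)\,ds\quad\text{for all }t\in[0,T],$$ where $u(s)\theta(s)\in L^1(\mathbb{R}^2)^2$ and the time integral is taken in the sense of tempered distributions, i.e. after pairing with an arbitrary Schwartz function (so the formula says that this distribution is the element $e^{t\Delta}\theta_0-\theta(t)$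 of $L^2$). Theorem. Let $T>0$ and let $\theta,\tilde\theta\in C([0,T];L^2(\mathbb{R}^2))$ be mild solutions such that $\theta(0)=\tilde\theta(0)$. Then $\theta(t)=\tilde\theta(t)$ in $L^2(\mathbb{R}^2)$ for all $t\in[0,T]$. -/

import Mathlib

open MeasureTheory Set
open scoped FourierTransform SchwartzMap

noncomputable section

namespace SQG

/-- The Euclidean plane `ℝ²`. -/
abbrev Plane : Type := EuclideanSpace ℝ (Fin 2)

/-- The real Lebesgue space `L²(ℝ²)`. -/
abbrev L2 : Type := Lp ℝ 2 (volume : Measure Plane)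

/-- The complex Lebesgue space `L²(ℝ²; ℂ)`. -/
abbrev L2C : Type := Lp ℂ 2 (volume : Measure Plane)

/-- The Fourier symbol of `∂_k`; the Fourier transform is `∫ exp(-2πi⟪x, ξ⟫) f(x) dx`. -/
def partialSymbol (k : Fin 2) (ξ : Plane) : ℂ := 2 * Real.pi * Complex.I * ξ k

/-- The Fourier symbol of `∇^⊥ = (-∂₂, ∂₁)`, componentwise (coordinates are numbered `0`, `1`). -/
def perpGradSymbol : Fin 2 → Plane → ℂ
  | 0, ξ => -partialSymbol 1 ξ
  | 1, ξ => partialSymbol 0 ξ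

/-- The Fourier symbol of `Λ = (-Δ)^{1/2}`. -/
def lambdaSymbol (ξ : Plane) : ℂ := ((2 * Real.pi * ‖ξ‖ : ℝ) : ℂ)

/-- The Fourier symbol of the components of `∇^⊥ Λ⁻¹`, that is `i (-ξ₂, ξ₁) / |ξ|`. -/
def velocitySymbol (k : Fin 2) (ξ : Plane) : ℂ := perpGradSymbol k ξ / lambdaSymbol ξ

lemma norm_partialSymbol (k : Fin 2) (ξ : Plane) :
    ‖partialSymbol k ξ‖ = 2 * Real.pi * |ξ k| := by
  simp [partialSymbol, abs_of_pos Real.pi_pos]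

lemma norm_velocitySymbol_le (k : Fin 2) (ξ : Plane) : ‖velocitySymbol k ξ‖ ≤ 1 := by
  have key : ∀ j : Fin 2, 2 * Real.pi * |ξ j| ≤ 2 * Real.pi * ‖ξ‖ := fun j => by
    have h := PiLp.norm_apply_le ξ j
    rw [Real.norm_eq_abs] at h
    have := Real.pi_pos
    gcongr
  have h2 : ‖lambdaSymbol ξ‖ = 2 * Real.pi * ‖ξ‖ := by
    rw [lambdaSymbol, Complex.norm_real, Real.norm_eq_abs]
    exact abs_of_nonneg (by positivity)
  rw [velocitySymbol, norm_div, h2]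
  apply div_le_one_of_le₀ _ (by positivity)
  fin_cases k
  · simpa [perpGradSymbol, norm_partialSymbol] using key 1
  · simpa [perpGradSymbol, norm_partialSymbol] using key 0

lemma measurable_velocitySymbol (k : Fin 2) : Measurable (velocitySymbol k) := by
  have hp : ∀ j : Fin 2, Measurable (partialSymbol j) := fun j => by
    unfold partialSymbol
    fun_prop
  have hl : Measurable lambdaSymbol := by
    unfold lambdaSymbol
    fun_prop
  unfold velocitySymbol
  fin_cases k
  · exact (hp 1).neg.div hl
  · exact (hp 0).div hl

lemma memLp_velocitySymbol_mul (k : Fin 2) (g : L2C) :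
    MemLp (fun ξ => velocitySymbol k ξ * g ξ) 2 (volume : Measure Plane) := by
  refine (Lp.memLp g).of_le
    ((measurable_velocitySymbol k).aestronglyMeasurable.mul (Lp.aestronglyMeasurable g))
    (Filter.Eventually.of_forall fun ξ => ?_)
  rw [norm_mul]
  exact mul_le_of_le_one_left (norm_nonneg _) (norm_velocitySymbol_le k ξ)

/-- The `k`-th component of `∇^⊥ Λ⁻¹` as a Fourier multiplier on `L²(ℝ²; ℂ)`. -/
def velocityC (k : Fin 2) (f : L2C) : L2C :=
  𝓕⁻ ((memLp_velocitySymbol_mul k (𝓕 f)).toLp (fun ξ => velocitySymbol k ξ * (𝓕 f : L2C) ξ))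

/-- The `k`-th component of the velocity `u = ∇^⊥ Λ⁻¹ θ` of a real `θ ∈ L²(ℝ²)`. The multiplier
maps real functions to real functions, so taking the real part only changes the type. -/
def velocity (k : Fin 2) (f : L2) : L2 :=
  Complex.reCLM.compLp (velocityC k (Complex.ofRealCLM.compLp f))

/-- The heat kernel of the plane, `(4πt)⁻¹ exp(-|z|²/(4t))` for `t > 0`. -/
def heatKernel (t : ℝ) (z : Plane) : ℝ :=
  (4 * Real.pi * t)⁻¹ * Real.exp (-‖z‖ ^ 2 / (4 * t))

/-- The heat semigroup `e^{tΔ}`, `t ≥ 0`: convolution with the heat kernel for `t > 0`, and the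
identity for `t = 0`. -/
def heat (t : ℝ) (f : Plane → ℝ) (x : Plane) : ℝ :=
  if t = 0 then f x else ∫ y, heatKernel t (x - y) * f y

/-- `∇ · e^{tΔ} F` for a planar vector field `F`. -/
def divHeat (t : ℝ) (F : Fin 2 → Plane → ℝ) (x : Plane) : ℝ :=
  ∑ k : Fin 2, lineDeriv ℝ (heat t (F k)) x (EuclideanSpace.single k 1)

/-- The flux `u θ` with `u = ∇^⊥ Λ⁻¹ θ`, a vector field in `L¹(ℝ²)`. -/
def flux (f : L2) (k : Fin 2) (x : Plane) : ℝ := velocity k f x * f x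

/-- `θ` is a mild solution on `[0, T]` of the dissipative surface quasi-geostrophic equation with
initial datum `θ₀`: it is continuous from `[0, T]` to `L²`, and for all `t ∈ [0, T]`
`θ(t) = e^{tΔ} θ₀ - ∫₀ᵗ ∇ · e^{(t-s)Δ} (u θ)(s) ds`.
The time integral of functions on the plane is taken in the sense of distributions, that is, after
pairing with a Schwartz function; all the integrals below converge absolutely. (The `L²` norm of
the integrand is only bounded by a multiple of `(t-s)⁻¹`, so a Bochner integral in `L²` need not
exist; wherever the integral exists in a stronger sense, it is the same element of `L²`.) Values of
`θ` outside `[0, T]` play no role. -/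
structure IsMildSolution (T : ℝ) (θ₀ : L2) (θ : ℝ → L2) : Prop where
  continuousOn : ContinuousOn θ (Icc 0 T)
  duhamel : ∀ t ∈ Icc 0 T, ∀ φ : 𝓢(Plane, ℝ),
    ∫ x, θ t x * φ x =
      (∫ x, heat t θ₀ x * φ x) -
        ∫ s in (0 : ℝ)..t, ∫ x, divHeat (t - s) (flux (θ s)) x * φ x

end SQG

end

/-!
The space `L²(ℝ²)` is critical for the equation, and the crude estimate of the Duhamel integral of
`∇ · e^{(t-s)Δ} (u θ)`, from `L¹` to `L²`, has the non-integrable kernel `(t-s)⁻¹`. Uniqueness rests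
on a cancellation. Write `w = θ - θ'` and `p = θ + θ'`. Polarizing the quadratic nonlinearity gives
a bilinear form in `(w, p)` whose symbol may be symmetrized in the two input frequencies `η` and
`ζ = ξ - η`. Since `ξ × ζ = -ξ × η`, symmetrizing turns `ξ × η / |η|`
into `ξ × η (1/|η| - 1/|ζ|)`, which is at most `|ξ|² / max (|η|, |ζ|)` in absolute value
(`norm_bilinSymbol_add_mul_le`, `two_mul_divFluxHat_sub`).

The factor `|ξ|²` is exactly what maximal regularity of the heat equation in `L²` of time absorbs:
at each frequency, the time convolution with `e^{-4π²r|ξ|²}` has norm at most `|ξ|⁻²` by Young's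
inequality (`lintegral_sq_duhamel_le`, `heatMass_mul_le`). The remaining bilinear operator with
kernel `1 / max (|η|, |ζ|)` maps `L² × L²` to `L²`, by Cauchy–Schwarz and the area of a disc
(`lintegral_sq_highKernel_le`). Hence the norm of `w` in `L²([a, a + δ] × ℝ²)` is bounded by itself
times a constant multiple of `sup ‖p‖`. To make the factor small, split the Fourier transform of
`p` into a compactly supported continuous `g`, close to the transform of `p(a)` in `L²`, and a
remainder. By continuity in time the remainder stays small on a short interval; for `g ∈ L¹` the
crude bound `4π|ξ|` on the symbol suffices and yields a power of `δ`
(`lintegral_sq_heatMass_mul_le_of_le`). So `w` vanishes a little beyond any `a` up to which it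
vanishes (`exists_gt_forall_eq`), and the set of such `a` is closed.

To get there, Duhamel's formula tested with Schwartz functions is turned into an identity at almost
every frequency (`fourier_sub_ae_eq`). This uses that the Fourier transform of a product of `L²`
functions is a convolution (`fourier_mul_eq`), and that the multiplier `∇^⊥ Λ⁻¹` preserves real
functions (`star_velocityC`), so that the real part in the definition of the velocity is harmless.
-/

namespace SQG

open scoped ENNReal

/-! ### Inequalities for nonnegative functions -/

section Lintegral

variable {α : Type*} [MeasurableSpace α] {μ : Measure α}

lemma sq_lintegral_mul_le {f g : α → ℝ≥0∞} (hf : AEMeasurable f μ) (hg : AEMeasurable g μ) :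
    (∫⁻ x, f x * g x ∂μ) ^ 2 ≤ (∫⁻ x, f x ^ 2 ∂μ) * ∫⁻ x, g x ^ 2 ∂μ := by
  have h := ENNReal.lintegral_mul_le_Lp_mul_Lq μ Real.HolderConjugate.two_two hf hg
  simp only [Pi.mul_apply, ENNReal.rpow_two] at h
  calc (∫⁻ x, f x * g x ∂μ) ^ 2
      ≤ ((∫⁻ x, f x ^ 2 ∂μ) ^ (1 / 2 : ℝ) * (∫⁻ x, g x ^ 2 ∂μ) ^ (1 / 2 : ℝ)) ^ 2 := by gcongr
    _ = _ := by
      rw [mul_pow, ← ENNReal.rpow_natCast, ← ENNReal.rpow_natCast, ← ENNReal.rpow_mul,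
        ← ENNReal.rpow_mul]
      norm_num

lemma sq_lintegral_mul_le_weight {k h : α → ℝ≥0∞} (hk : AEMeasurable k μ)
    (hh : AEMeasurable h μ) :
    (∫⁻ x, h x * k x ∂μ) ^ 2 ≤ (∫⁻ x, k x ∂μ) * ∫⁻ x, h x ^ 2 * k x ∂μ := by
  have hsq : ∀ x, (k x ^ (1 / 2 : ℝ)) ^ 2 = k x := fun x => by
    rw [← ENNReal.rpow_natCast, ← ENNReal.rpow_mul]
    norm_num
  have := sq_lintegral_mul_le (hk.pow_const (1 / 2 : ℝ)) (hh.mul (hk.pow_const (1 / 2 : ℝ)))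
  simp only [Pi.mul_apply, mul_pow, hsq] at this
  refine le_trans (le_of_eq ?_) this
  congr 1
  refine lintegral_congr fun x => ?_
  rw [mul_left_comm, ← sq, hsq]

lemma add_sq_le_two_mul (a b : ℝ≥0∞) : (a + b) ^ 2 ≤ 2 * (a ^ 2 + b ^ 2) := by
  have := ENNReal.rpow_add_le_mul_rpow_add_rpow a b (p := 2) (by norm_num)
  norm_num at this
  exact this

end Lintegral

/-- Young's inequality `‖a ⋆ k‖₂ ≤ ‖k‖₁ ‖a‖₂` for nonnegative functions. -/
lemma lintegral_sq_conv_le {G : Type*} [AddCommGroup G] [MeasurableSpace G] [MeasurableAdd₂ G]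
    [MeasurableNeg G] (μ : Measure G) [SFinite μ] [μ.IsAddLeftInvariant] [μ.IsNegInvariant]
    {a k : G → ℝ≥0∞} (ha : Measurable a) (hk : Measurable k) :
    ∫⁻ x, (∫⁻ y, a y * k (x - y) ∂μ) ^ 2 ∂μ ≤ (∫⁻ x, k x ∂μ) ^ 2 * ∫⁻ x, a x ^ 2 ∂μ := by
  have hsub : Measurable fun p : G × G => p.1 - p.2 := by
    simp only [sub_eq_add_neg]; fun_prop
  have hk2 : Measurable fun p : G × G => k (p.1 - p.2) := hk.comp hsub
  calc ∫⁻ x, (∫⁻ y, a y * k (x - y) ∂μ) ^ 2 ∂μ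
      ≤ ∫⁻ x, (∫⁻ y, k y ∂μ) * ∫⁻ y, a y ^ 2 * k (x - y) ∂μ ∂μ := by
        refine lintegral_mono fun x => ?_
        have hx : Measurable fun y => k (x - y) :=
          hk2.comp (by fun_prop : Measurable fun y => (x, y))
        refine (sq_lintegral_mul_le_weight hx.aemeasurable ha.aemeasurable).trans (le_of_eq ?_)
        rw [lintegral_sub_left_eq_self]
    _ = (∫⁻ y, k y ∂μ) * ∫⁻ x, ∫⁻ y, a y ^ 2 * k (x - y) ∂μ ∂μ := by
        rw [lintegral_const_mul]
        exact Measurable.lintegral_prod_right' (f := fun p : G × G => a p.2 ^ 2 * k (p.1 - p.2))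
          (by fun_prop)
    _ = (∫⁻ y, k y ∂μ) * ∫⁻ y, a y ^ 2 * ∫⁻ x, k x ∂μ ∂μ := by
        have hm : Measurable fun p : G × G => a p.2 ^ 2 * k (p.1 - p.2) := by fun_prop
        rw [lintegral_lintegral_swap (by exact hm.aemeasurable)]
        congr 1
        refine lintegral_congr fun y => ?_
        rw [lintegral_const_mul]
        · rw [lintegral_sub_right_eq_self (fun x => k x)]
        · exact hk2.comp (by fun_prop : Measurable fun x => (x, y))
    _ = _ := by
        rw [lintegral_mul_const _ (by fun_prop)]
        ring

/-- The bilinear kernel `1 / max (|η|, |ζ|)`: up to a constant, a bound for the symmetrized symbol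
of the nonlinearity divided by `|ξ|²`, where `ξ = η + ζ`. It is `∞` at `η = ζ = 0`. -/
noncomputable def highKernel (η ζ : Plane) : ℝ≥0∞ := (max ‖η‖ₑ ‖ζ‖ₑ)⁻¹

/-- One half of the bilinear estimate, with the kernel restricted to `|ξ - η| ≤ |η|`. By
Cauchy–Schwarz the square of the inner integral is at most `‖b‖₂² ∫ |a(η)|² / |η|² dη`, and for
each `η` the disc `|ξ - η| ≤ |η|` has area `π |η|²`. -/
lemma lintegral_sq_near_le {a b : Plane → ℝ≥0∞} (ha : Measurable a) (hb : Measurable b) :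
    ∫⁻ ξ, (∫⁻ η, a η * b (ξ - η) *
        ({p : Plane × Plane | ‖p.1 - p.2‖ₑ ≤ ‖p.2‖ₑ}.indicator (fun p => ‖p.2‖ₑ⁻¹) (ξ, η))) ^ 2 ≤
      ENNReal.ofReal Real.pi * (∫⁻ η, a η ^ 2) * ∫⁻ η, b η ^ 2 := by
  set S := {p : Plane × Plane | ‖p.1 - p.2‖ₑ ≤ ‖p.2‖ₑ} with hS
  set K : Plane × Plane → ℝ≥0∞ := S.indicator (fun p => ‖p.2‖ₑ⁻¹) with hK
  have hSm : MeasurableSet S := measurableSet_le (by fun_prop) (by fun_prop)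
  have hKm : Measurable K := Measurable.indicator (by fun_prop) hSm
  have hvol : ∀ η : Plane, η ≠ 0 → ∫⁻ ξ, K (ξ, η) ^ 2 = ENNReal.ofReal Real.pi := by
    intro η hη
    have h1 : ∀ ξ, K (ξ, η) ^ 2 = (Metric.closedBall η ‖η‖).indicator (fun _ => ‖η‖ₑ⁻¹ ^ 2) ξ := by
      intro ξ
      have hiff : (ξ, η) ∈ S ↔ ξ ∈ Metric.closedBall η ‖η‖ := by
        simp only [hS, mem_ofPred_eq, Metric.mem_closedBall, dist_eq_norm]
        rw [← ofReal_norm, ← ofReal_norm, ENNReal.ofReal_le_ofReal_iff (norm_nonneg _)]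
      by_cases h : (ξ, η) ∈ S
      · rw [hK, indicator_of_mem h, indicator_of_mem (hiff.1 h)]
      · rw [hK, indicator_of_notMem h, indicator_of_notMem (fun h' => h (hiff.2 h'))]
        simp
    simp_rw [h1]
    rw [lintegral_indicator_const measurableSet_closedBall,
      EuclideanSpace.volume_closedBall_fin_two, ofReal_norm, ← mul_assoc, ← mul_pow,
      ENNReal.inv_mul_cancel (by simpa using hη) (by simp)]
    simp
  calc ∫⁻ ξ, (∫⁻ η, a η * b (ξ - η) * K (ξ, η)) ^ 2
      ≤ ∫⁻ ξ, (∫⁻ η, b η ^ 2) * ∫⁻ η, (a η * K (ξ, η)) ^ 2 := by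
        refine lintegral_mono fun ξ => ?_
        have h1 : Measurable fun η => b (ξ - η) := by fun_prop
        have h2 : Measurable fun η => a η * K (ξ, η) := by fun_prop
        have := sq_lintegral_mul_le (μ := volume) h1.aemeasurable h2.aemeasurable
        rw [lintegral_sub_left_eq_self (fun η => b η ^ 2)] at this
        refine le_trans (le_of_eq ?_) this
        congr 1
        exact lintegral_congr fun η => by ring
    _ = (∫⁻ η, b η ^ 2) * ∫⁻ ξ, ∫⁻ η, (a η * K (ξ, η)) ^ 2 := by
        rw [lintegral_const_mul]
        exact Measurable.lintegral_prod_right' (f := fun p : Plane × Plane => (a p.2 * K p) ^ 2)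
          (by fun_prop)
    _ = (∫⁻ η, b η ^ 2) * ∫⁻ η, a η ^ 2 * ENNReal.ofReal Real.pi := by
        have hm : Measurable fun p : Plane × Plane => (a p.2 * K p) ^ 2 := by fun_prop
        rw [lintegral_lintegral_swap (by exact hm.aemeasurable)]
        congr 1
        refine lintegral_congr_ae ?_
        filter_upwards [Measure.ae_ne volume (0 : Plane)] with η hη
        simp_rw [mul_pow]
        rw [lintegral_const_mul _ (by fun_prop), hvol η hη]
    _ = _ := by
        rw [lintegral_mul_const _ (by fun_prop)]
        ring

/-- The scale-invariant bilinear estimate `L² × L² → L²` behind uniqueness: the reflection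
`η ↦ ξ - η` reduces it to the region where `η` is the larger input frequency. -/
lemma lintegral_sq_highKernel_le {a b : Plane → ℝ≥0∞} (ha : Measurable a) (hb : Measurable b) :
    ∫⁻ ξ, (∫⁻ η, a η * b (ξ - η) * highKernel η (ξ - η)) ^ 2 ≤
      4 * ENNReal.ofReal Real.pi * (∫⁻ η, a η ^ 2) * ∫⁻ η, b η ^ 2 := by
  set S := {p : Plane × Plane | ‖p.1 - p.2‖ₑ ≤ ‖p.2‖ₑ} with hS
  set K : Plane × Plane → ℝ≥0∞ := S.indicator (fun p => ‖p.2‖ₑ⁻¹) with hK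
  have hSm : MeasurableSet S := measurableSet_le (by fun_prop) (by fun_prop)
  have hKm : Measurable K := Measurable.indicator (by fun_prop) hSm
  have hle : ∀ ξ η, highKernel η (ξ - η) ≤ K (ξ, η) + K (ξ, ξ - η) := by
    intro ξ η
    rcases le_total ‖ξ - η‖ₑ ‖η‖ₑ with h | h
    · have : K (ξ, η) = ‖η‖ₑ⁻¹ := indicator_of_mem (by exact h) _
      rw [this, highKernel, max_eq_left h]
      exact le_self_add
    · have : K (ξ, ξ - η) = ‖ξ - η‖ₑ⁻¹ := indicator_of_mem (by simpa [hS] using h) _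
      rw [this, highKernel, max_eq_right h]
      exact le_add_self
  have hm : ∀ f g : Plane → ℝ≥0∞, Measurable f → Measurable g → Measurable fun ξ =>
      ∫⁻ η, f η * g (ξ - η) * K (ξ, η) := fun f g hf hg =>
    Measurable.lintegral_prod_right' (f := fun p : Plane × Plane => f p.2 * g (p.1 - p.2) * K p)
      (by fun_prop)
  calc ∫⁻ ξ, (∫⁻ η, a η * b (ξ - η) * highKernel η (ξ - η)) ^ 2
      ≤ ∫⁻ ξ, 2 * ((∫⁻ η, a η * b (ξ - η) * K (ξ, η)) ^ 2 +
          (∫⁻ η, b η * a (ξ - η) * K (ξ, η)) ^ 2) := by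
        refine lintegral_mono fun ξ => ?_
        refine le_trans ?_ (add_sq_le_two_mul _ _)
        gcongr
        calc ∫⁻ η, a η * b (ξ - η) * highKernel η (ξ - η)
            ≤ ∫⁻ η, (a η * b (ξ - η) * K (ξ, η) + a η * b (ξ - η) * K (ξ, ξ - η)) := by
              refine lintegral_mono fun η => ?_
              rw [← mul_add]
              gcongr
              exact hle ξ η
          _ = (∫⁻ η, a η * b (ξ - η) * K (ξ, η)) +
                ∫⁻ η, a η * b (ξ - η) * K (ξ, ξ - η) := lintegral_add_left (by fun_prop) _
          _ = _ := by
              congr 1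
              rw [← lintegral_sub_left_eq_self _ ξ]
              refine lintegral_congr fun η => ?_
              simp only [sub_sub_cancel]
              ring
    _ = 2 * ((∫⁻ ξ, (∫⁻ η, a η * b (ξ - η) * K (ξ, η)) ^ 2) +
          ∫⁻ ξ, (∫⁻ η, b η * a (ξ - η) * K (ξ, η)) ^ 2) := by
        rw [lintegral_const_mul' _ _ (by simp),
          lintegral_add_left ((hm a b ha hb).pow_const 2)]
    _ ≤ 2 * (ENNReal.ofReal Real.pi * (∫⁻ η, a η ^ 2) * (∫⁻ η, b η ^ 2) +
          ENNReal.ofReal Real.pi * (∫⁻ η, b η ^ 2) * ∫⁻ η, a η ^ 2) := by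
        gcongr
        · exact lintegral_sq_near_le ha hb
        · exact lintegral_sq_near_le hb ha
    _ = _ := by ring

/-! ### The Fourier transform on `L²` -/

lemma integral_mul_eq_inner (f h : L2C) : ∫ x, f x * h x = inner ℂ (star h) f := by
  rw [L2.inner_def]
  refine integral_congr_ae ?_
  filter_upwards [Lp.coeFn_star h] with x hx
  rw [hx]
  simp

lemma continuous_integral_mul {h : Plane → ℂ} (hh : MemLp h 2 volume) :
    Continuous fun f : L2C => ∫ x, f x * h x := by
  have : (fun f : L2C => ∫ x, f x * h x) = fun f => inner ℂ (star hh.toLp) f := by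
    funext f
    rw [← integral_mul_eq_inner]
    refine integral_congr_ae ?_
    filter_upwards [hh.coeFn_toLp] with x hx
    rw [hx]
  rw [this]
  fun_prop

lemma L2C_induction {p : L2C → Prop} (f : L2C) (hp : IsClosed {f | p f})
    (h : ∀ g : 𝓢(Plane, ℂ), p (g.toLp 2)) : p f :=
  DenseRange.induction_on (p := p)
    (SchwartzMap.denseRange_toLpCLM (F := ℂ) (p := 2) ENNReal.ofNat_ne_top) f hp h

/-- The multiplication formula `∫ f φ = ∫ 𝓕 f 𝓕⁻ φ`. -/
lemma integral_mul_schwartz (f : L2C) (φ : 𝓢(Plane, ℂ)) :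
    ∫ x, f x * φ x = ∫ ξ, (𝓕 f : L2C) ξ * (𝓕⁻ φ) ξ := by
  have h := congrArg (fun D => D (𝓕⁻ φ)) (Lp.fourier_toTemperedDistribution_eq f)
  simp only [TemperedDistribution.fourier_apply, Lp.toTemperedDistribution_apply,
    FourierTransform.fourier_fourierInv_eq, smul_eq_mul] at h
  simpa only [mul_comm] using h

lemma continuous_star_L2C : Continuous fun f : L2C => star f := by
  have h : (fun f : L2C => star f) =
      fun f => (Complex.conjCLE : ℂ →L[ℝ] ℂ).compLpL 2 volume f := by
    funext f
    refine Lp.ext ?_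
    filter_upwards [Lp.coeFn_star f, (Complex.conjCLE : ℂ →L[ℝ] ℂ).coeFn_compLpL f] with x h1 h2
    rw [h1, h2]
    rfl
  rw [h]
  fun_prop

/-- The Fourier transform turns complex conjugation into conjugation and reflection. -/
lemma fourier_star (f : L2C) :
    ∀ᵐ ξ, (𝓕 (star f) : L2C) ξ = starRingEnd ℂ ((𝓕 f : L2C) (-ξ)) := by
  have hneg : MeasurePreserving (Neg.neg : Plane → Plane) volume volume :=
    Measure.measurePreserving_neg volume
  let R : L2C → L2C := Lp.compMeasurePreserving _ hneg
  have hR : ∀ g : L2C, R g =ᵐ[volume] fun ξ => g (-ξ) := fun g =>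
    Lp.coeFn_compMeasurePreserving g hneg
  have hRc : Continuous R := (Lp.isometry_compMeasurePreserving hneg).continuous
  suffices h : (𝓕 (star f) : L2C) = star (R (𝓕 f)) by
    filter_upwards [Lp.coeFn_star (R (𝓕 f)), hR (𝓕 f)] with ξ h1 h2
    rw [h, h1, Pi.star_apply, h2]
    rfl
  refine L2C_induction (p := fun f => (𝓕 (star f) : L2C) = star (R (𝓕 f))) f
    (isClosed_eq ?_ ?_) fun g => ?_
  · have hF : Continuous (fun f : L2C => (𝓕 f : L2C)) := ContinuousFourier.continuous_fourier
    exact hF.comp continuous_star_L2C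
  · have hF : Continuous (fun f : L2C => (𝓕 f : L2C)) := ContinuousFourier.continuous_fourier
    exact continuous_star_L2C.comp (hRc.comp hF)
  · let gc : 𝓢(Plane, ℂ) := SchwartzMap.postcompCLM (𝕜 := ℝ) (Complex.conjCLE : ℂ →L[ℝ] ℂ) g
    have hgc : ∀ x, gc x = starRingEnd ℂ (g x) := fun x => rfl
    have h1 : star (g.toLp 2 : L2C) = gc.toLp 2 := by
      refine Lp.ext ?_
      filter_upwards [Lp.coeFn_star (g.toLp 2 : L2C), g.coeFn_toLp 2 volume,
        gc.coeFn_toLp 2 volume] with x h1 h2 h3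
      rw [h1, h3, Pi.star_apply, h2, hgc]
      rfl
    rw [h1, SchwartzMap.toLp_fourier_eq, SchwartzMap.toLp_fourier_eq]
    refine Lp.ext ?_
    filter_upwards [Lp.coeFn_star (R ((𝓕 g).toLp 2)), hR ((𝓕 g).toLp 2),
      (𝓕 gc).coeFn_toLp 2 volume,
      hneg.quasiMeasurePreserving.ae ((𝓕 g).coeFn_toLp 2 volume)] with ξ h1 h2 h3 h4
    rw [h3, h1, Pi.star_apply, h2, h4, SchwartzMap.fourier_coe, SchwartzMap.fourier_coe,
      Real.fourier_eq', Real.fourier_eq']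
    change _ = starRingEnd ℂ _
    rw [← integral_conj]
    refine integral_congr_ae (.of_forall fun x => ?_)
    simp only [hgc, smul_eq_mul, map_mul, ← Complex.exp_conj, inner_neg_right, Complex.conj_ofReal,
      Complex.conj_I]
    congr 2
    push_cast
    ring

/-- The multiplication formula, applied to `φ` and `η ↦ 𝓕 ψ (ξ - η)`, together with Fourier
inversion. -/
lemma fourier_schwartz_mul_eq (φ ψ : 𝓢(Plane, ℂ)) (ξ : Plane) :
    𝓕 (fun x => φ x * ψ x) ξ = ∫ η, (𝓕 φ : 𝓢(Plane, ℂ)) η * (𝓕 ψ : 𝓢(Plane, ℂ)) (ξ - η) := by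
  obtain ⟨Ψ, rfl⟩ : ∃ Ψ : 𝓢(Plane, ℂ), ψ = 𝓕⁻ Ψ :=
    ⟨𝓕 ψ, (FourierTransform.fourierInv_fourier_eq ψ).symm⟩
  rw [FourierTransform.fourier_fourierInv_eq]
  have h3 : ∀ x, 𝓕 (fun η => Ψ (ξ - η)) x =
      (Real.fourierChar (-(inner ℝ x ξ)) : ℂ) * (𝓕⁻ Ψ : 𝓢(Plane, ℂ)) x := by
    intro x
    rw [SchwartzMap.fourierInv_coe, Real.fourier_eq, Real.fourierInv_eq, ← integral_const_mul,
      ← integral_sub_left_eq_self _ volume ξ]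
    refine integral_congr_ae (.of_forall fun η => ?_)
    simp only [sub_sub_cancel, Circle.smul_def, smul_eq_mul, inner_sub_left]
    rw [← mul_assoc, ← Circle.coe_mul, ← AddChar.map_add_eq_mul, real_inner_comm ξ x]
    congr 3
    ring
  have h4 := VectorFourier.integral_fourierIntegral_smul_eq_flip (μ := volume) (ν := volume)
    (L := innerₗ Plane) (f := (φ : Plane → ℂ)) (g := fun η => Ψ (ξ - η))
    Real.continuous_fourierChar continuous_inner φ.integrable
    (Ψ.integrable.comp_sub_left ξ)
  rw [flip_innerₗ] at h4
  rw [SchwartzMap.fourier_coe]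
  refine Eq.trans ?_ h4.symm
  rw [Real.fourier_eq]
  refine integral_congr_ae (.of_forall fun x => ?_)
  change _ = φ x • 𝓕 (fun η => Ψ (ξ - η)) x
  simp only [h3, Circle.smul_def, smul_eq_mul]
  ring

lemma fourier_mul_eq_schwartz (φ ψ : 𝓢(Plane, ℂ)) (ξ : Plane) :
    𝓕 (fun x => (φ.toLp 2 volume : L2C) x * (ψ.toLp 2 volume : L2C) x) ξ =
      ∫ η, (𝓕 (φ.toLp 2 volume : L2C) : L2C) η * (𝓕 (ψ.toLp 2 volume : L2C) : L2C) (ξ - η) := by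
  have hsub : MeasurePreserving (fun η : Plane => ξ - η) volume volume :=
    Measure.measurePreserving_sub_left volume ξ
  rw [SchwartzMap.toLp_fourier_eq, SchwartzMap.toLp_fourier_eq]
  have h1 : 𝓕 (fun x => (φ.toLp 2 volume : L2C) x * (ψ.toLp 2 volume : L2C) x) ξ =
      𝓕 (fun x => φ x * ψ x) ξ := by
    refine Real.fourier_congr_ae ?_ ξ
    filter_upwards [φ.coeFn_toLp 2 volume, ψ.coeFn_toLp 2 volume] with x h1 h2
    rw [h1, h2]
  rw [h1, fourier_schwartz_mul_eq]
  generalize (𝓕 φ : 𝓢(Plane, ℂ)) = Φ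
  generalize (𝓕 ψ : 𝓢(Plane, ℂ)) = Ψ
  refine integral_congr_ae ?_
  filter_upwards [Φ.coeFn_toLp 2 volume,
    hsub.quasiMeasurePreserving.ae (Ψ.coeFn_toLp 2 volume)] with x h1 h2
  rw [h1, h2]

/-- The Fourier transform of a product of two `L²` functions is the convolution of their Fourier
transforms, at every point. Both sides are continuous in each factor, so Schwartz functions
suffice. -/
lemma fourier_mul_eq (f g : L2C) (ξ : Plane) :
    𝓕 (fun x => f x * g x) ξ = ∫ η, (𝓕 f : L2C) η * (𝓕 g : L2C) (ξ - η) := by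
  have hF : Continuous (fun f : L2C => (𝓕 f : L2C)) := ContinuousFourier.continuous_fourier
  have hsub : MeasurePreserving (fun η : Plane => ξ - η) volume volume :=
    Measure.measurePreserving_sub_left volume ξ
  have hchar : ∀ g : L2C,
      MemLp (fun x => (Real.fourierChar (-(inner ℝ x ξ)) : ℂ) * g x) 2 volume := by
    intro g
    refine (Lp.memLp g).of_le (AEStronglyMeasurable.mul ?_ (Lp.aestronglyMeasurable g))
      (.of_forall fun x => by rw [norm_mul, Circle.norm_coe, one_mul])
    exact (by fun_prop : Continuous fun x : Plane =>
      (Real.fourierChar (-(inner ℝ x ξ)) : ℂ)).aestronglyMeasurable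
  have hL : ∀ f g : L2C, 𝓕 (fun x => f x * g x) ξ =
      ∫ x, f x * ((Real.fourierChar (-(inner ℝ x ξ)) : ℂ) * g x) := by
    intro f g
    rw [Real.fourier_eq]
    refine integral_congr_ae (.of_forall fun x => ?_)
    simp only [Circle.smul_def, smul_eq_mul]
    ring
  have hL' : ∀ f g : L2C, 𝓕 (fun x => f x * g x) ξ =
      ∫ x, g x * ((Real.fourierChar (-(inner ℝ x ξ)) : ℂ) * f x) := by
    intro f g
    rw [← hL g f]
    exact Real.fourier_congr_ae (.of_forall fun x => mul_comm _ _) ξ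
  have hR : ∀ f g : L2C, ∫ η, (𝓕 f : L2C) η * (𝓕 g : L2C) (ξ - η) =
      ∫ η, (𝓕 g : L2C) η * (𝓕 f : L2C) (ξ - η) := by
    intro f g
    rw [← integral_sub_left_eq_self _ volume ξ]
    refine integral_congr_ae (.of_forall fun η => ?_)
    simp only [sub_sub_cancel]
    exact mul_comm _ _
  have hRm : ∀ g : L2C, MemLp (fun η => g (ξ - η)) 2 volume := fun g =>
    (Lp.memLp g).comp_measurePreserving hsub
  refine L2C_induction (p := fun f => 𝓕 (fun x => f x * g x) ξ =
    ∫ η, (𝓕 f : L2C) η * (𝓕 g : L2C) (ξ - η)) f (isClosed_eq ?_ ?_) fun φ => ?_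
  · simp_rw [hL]
    exact continuous_integral_mul (hchar g)
  · exact (continuous_integral_mul (hRm (𝓕 g))).comp hF
  refine L2C_induction (p := fun g => 𝓕 (fun x => (φ.toLp 2 : L2C) x * g x) ξ =
    ∫ η, (𝓕 (φ.toLp 2 : L2C) : L2C) η * (𝓕 g : L2C) (ξ - η)) g (isClosed_eq ?_ ?_) fun ψ => ?_
  · simp_rw [hL']
    exact continuous_integral_mul (hchar _)
  · exact ((continuous_integral_mul (hRm (𝓕 (φ.toLp 2 volume : L2C)))).comp hF).congr
      fun g => (hR (φ.toLp 2 volume) g).symm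
  exact fourier_mul_eq_schwartz φ ψ ξ

/-! ### Velocity and flux on the Fourier side -/

/-- A real `L²` function, regarded as a complex one. -/
noncomputable abbrev complexify (f : L2) : L2C := Complex.ofRealCLM.compLp f

lemma coeFn_complexify (f : L2) : complexify f =ᵐ[volume] fun x => (f x : ℂ) :=
  Complex.ofRealCLM.coeFn_compLp f

lemma complexify_sub (f g : L2) : complexify (f - g) = complexify f - complexify g :=
  map_sub (Complex.ofRealCLM.compLpL 2 volume) f g

lemma complexify_add (f g : L2) : complexify (f + g) = complexify f + complexify g :=
  map_add (Complex.ofRealCLM.compLpL 2 volume) f g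

lemma norm_complexify (f : L2) : ‖complexify f‖ = ‖f‖ := by
  refine le_antisymm (Lp.norm_le_norm_of_ae_le ?_) (Lp.norm_le_norm_of_ae_le ?_) <;>
  · filter_upwards [coeFn_complexify f] with x hx
    simp [hx]

lemma continuous_complexify : Continuous complexify :=
  (Complex.ofRealCLM.compLpL 2 volume).continuous

lemma star_complexify (f : L2) : star (complexify f) = complexify f := by
  refine Lp.ext ?_
  filter_upwards [Lp.coeFn_star (complexify f), coeFn_complexify f] with x h1 h2
  rw [h1, Pi.star_apply, h2]
  simp

lemma fourier_sub_L2C (f g : L2C) : (𝓕 (f - g) : L2C) = 𝓕 f - 𝓕 g :=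
  (Lp.fourierTransformₗᵢ Plane ℂ).map_sub f g

lemma fourier_add_L2C (f g : L2C) : (𝓕 (f + g) : L2C) = 𝓕 f + 𝓕 g :=
  (Lp.fourierTransformₗᵢ Plane ℂ).map_add f g

lemma fourier_velocityC (k : Fin 2) (f : L2C) :
    (𝓕 (velocityC k f) : L2C) =ᵐ[volume] fun ξ => velocitySymbol k ξ * (𝓕 f : L2C) ξ := by
  rw [velocityC, FourierTransform.fourier_fourierInv_eq]
  exact MemLp.coeFn_toLp _

lemma velocityC_sub (k : Fin 2) (f g : L2C) :
    velocityC k (f - g) = velocityC k f - velocityC k g := by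
  apply (Lp.fourierTransformₗᵢ Plane ℂ).injective
  change 𝓕 (velocityC k (f - g)) = 𝓕 (velocityC k f - velocityC k g)
  rw [fourier_sub_L2C]
  refine Lp.ext ?_
  have h := fourier_velocityC k (f - g)
  rw [fourier_sub_L2C] at h
  filter_upwards [h, fourier_velocityC k f, fourier_velocityC k g,
    Lp.coeFn_sub (𝓕 f : L2C) (𝓕 g), Lp.coeFn_sub (𝓕 (velocityC k f) : L2C) (𝓕 (velocityC k g))]
    with ξ h1 h2 h3 h4 h5
  rw [h1, h5, Pi.sub_apply, h2, h3, h4, Pi.sub_apply, mul_sub]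

lemma norm_velocityC_le (k : Fin 2) (f : L2C) : ‖velocityC k f‖ ≤ ‖f‖ := by
  rw [← Lp.norm_fourier_eq (velocityC k f), ← Lp.norm_fourier_eq f]
  refine Lp.norm_le_norm_of_ae_le ?_
  filter_upwards [fourier_velocityC k f] with ξ h
  rw [h, norm_mul]
  exact mul_le_of_le_one_left (norm_nonneg _) (norm_velocitySymbol_le k ξ)

lemma continuous_velocityC (k : Fin 2) : Continuous (velocityC k) := by
  refine LipschitzWith.continuous (K := 1) (LipschitzWith.of_dist_le_mul fun f g => ?_)
  rw [dist_eq_norm, dist_eq_norm, ← velocityC_sub, NNReal.coe_one, one_mul]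
  exact norm_velocityC_le k _

lemma velocitySymbol_neg (k : Fin 2) (ξ : Plane) :
    velocitySymbol k (-ξ) = starRingEnd ℂ (velocitySymbol k ξ) := by
  fin_cases k <;>
  simp [velocitySymbol, perpGradSymbol, partialSymbol, lambdaSymbol, map_ofNat]

/-- The multiplier `∇^⊥ Λ⁻¹` preserves real functions, because its symbol is Hermitian. -/
lemma star_velocityC (k : Fin 2) (f : L2C) : star (velocityC k f) = velocityC k (star f) := by
  apply (Lp.fourierTransformₗᵢ Plane ℂ).injective
  refine Lp.ext ?_
  have hneg := (Measure.measurePreserving_neg (volume : Measure Plane)).quasiMeasurePreserving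
  filter_upwards [fourier_star (velocityC k f), fourier_velocityC k (star f), fourier_star f,
    hneg.ae (fourier_velocityC k f)] with ξ h1 h2 h3 h4
  refine h1.trans (Eq.trans ?_ h2.symm)
  rw [h4, h3, map_mul, velocitySymbol_neg, Complex.conj_conj]

/-- Taking the real part in the definition of `velocity` loses nothing. -/
lemma complexify_velocity (k : Fin 2) (f : L2) :
    complexify (velocity k f) = velocityC k (complexify f) := by
  refine Lp.ext ?_
  have h := star_velocityC k (complexify f)
  rw [star_complexify] at h
  have h' := Lp.coeFn_star (velocityC k (complexify f))
  rw [h] at h'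
  filter_upwards [coeFn_complexify (velocity k f),
    Complex.reCLM.coeFn_compLp (velocityC k (complexify f)), h'] with x h1 h2 h3
  rw [h1]
  have h2' : velocity k f x = Complex.reCLM (velocityC k (complexify f) x) := h2
  rw [h2']
  exact Complex.conj_eq_iff_re.1 h3.symm

lemma flux_ae_eq (k : Fin 2) (f : L2) : (fun x => (flux f k x : ℂ)) =ᵐ[volume]
    fun x => velocityC k (complexify f) x * complexify f x := by
  have h := coeFn_complexify (velocity k f)
  rw [complexify_velocity] at h
  filter_upwards [coeFn_complexify f, h] with x h1 h2
  rw [h1, h2, flux]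
  push_cast
  rfl

lemma integrable_flux (k : Fin 2) (f : L2) : Integrable (flux f k) :=
  MemLp.integrable_mul (Lp.memLp (velocity k f)) (Lp.memLp f)

/-- The Fourier transform of the flux, as a continuous function. -/
noncomputable def fluxHat (k : Fin 2) (f : L2) (ξ : Plane) : ℂ := 𝓕 (fun x => (flux f k x : ℂ)) ξ

lemma fluxHat_eq (k : Fin 2) (f : L2) (ξ : Plane) :
    fluxHat k f ξ = ∫ η, velocitySymbol k η *
      ((𝓕 (complexify f) : L2C) η * (𝓕 (complexify f) : L2C) (ξ - η)) := by
  rw [fluxHat, Real.fourier_congr_ae (flux_ae_eq k f), fourier_mul_eq]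
  refine integral_congr_ae ?_
  filter_upwards [fourier_velocityC k (complexify f)] with η h
  rw [h]
  ring

/-- `fluxHat` as a composition of the continuous maps `L² × L² → L¹` and `𝓕 : L¹ → C_b`, which
gives its joint continuity and its bound. -/
lemma fluxHat_eq_fourierTransformCLM (k : Fin 2) (f : L2) (ξ : Plane) :
    fluxHat k f ξ = Real.Lp.fourierTransformCLM Plane ℂ
      ((ContinuousLinearMap.mul ℂ ℂ).holderL volume 2 2 1
        (velocityC k (complexify f)) (complexify f)) ξ := by
  rw [Real.Lp.fourierTransformCLM_apply, Real.Lp.fourierTransform_apply, fluxHat]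
  refine Real.fourier_congr_ae ((flux_ae_eq k f).trans ?_) _
  exact ((ContinuousLinearMap.mul ℂ ℂ).coeFn_holder _ _).symm

lemma continuous_fluxHat (k : Fin 2) : Continuous fun p : L2 × Plane => fluxHat k p.1 p.2 := by
  simp_rw [fluxHat_eq_fourierTransformCLM]
  have hc := continuous_complexify
  have hv := continuous_velocityC k
  have h1 : Continuous fun p : L2 × Plane =>
      (ContinuousLinearMap.mul ℂ ℂ).holderL volume 2 2 1 (velocityC k (complexify p.1)) := by
    fun_prop
  have h2 := (Real.Lp.fourierTransformCLM Plane ℂ).continuous.comp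
    (h1.clm_apply (hc.comp continuous_fst))
  exact ContinuousEval.continuous_eval.comp (h2.prodMk continuous_snd)

lemma exists_norm_fluxHat_le : ∃ C : ℝ, ∀ k f ξ, ‖fluxHat k f ξ‖ ≤ C * ‖f‖ ^ 2 := by
  set B : L2C →L[ℂ] L2C →L[ℂ] Lp ℂ 1 (volume : Measure Plane) :=
    (ContinuousLinearMap.mul ℂ ℂ).holderL volume 2 2 1
  refine ⟨‖Real.Lp.fourierTransformCLM Plane ℂ‖ * ‖B‖, fun k f ξ => ?_⟩
  rw [fluxHat_eq_fourierTransformCLM]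
  refine (BoundedContinuousFunction.norm_coe_le_norm _ _).trans ?_
  refine (ContinuousLinearMap.le_opNorm _ _).trans ?_
  rw [mul_assoc]
  gcongr
  refine (ContinuousLinearMap.le_opNorm₂ B _ _).trans ?_
  rw [mul_assoc, sq]
  have := norm_velocityC_le k (complexify f)
  have h2 := norm_complexify f
  rw [h2] at this ⊢
  gcongr

/-! ### The heat semigroup on the Fourier side -/

/-- The Fourier symbol `exp(-4π²r|ξ|²)` of `e^{rΔ}`. -/
noncomputable def heatSymbol (r : ℝ) (ξ : Plane) : ℝ := Real.exp (-(4 * Real.pi ^ 2 * r * ‖ξ‖ ^ 2))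

lemma continuous_heatSymbol : Continuous fun p : ℝ × Plane => heatSymbol p.1 p.2 := by
  unfold heatSymbol
  fun_prop

lemma heatSymbol_pos (r : ℝ) (ξ : Plane) : 0 < heatSymbol r ξ := Real.exp_pos _

lemma heatSymbol_le_one {r : ℝ} (hr : 0 ≤ r) (ξ : Plane) : heatSymbol r ξ ≤ 1 := by
  rw [heatSymbol, Real.exp_le_one_iff]
  have : 0 ≤ 4 * Real.pi ^ 2 * r * ‖ξ‖ ^ 2 := by positivity
  linarith

lemma fourier_heatSymbol {r : ℝ} (hr : 0 < r) (z : Plane) :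
    𝓕 (fun ξ => (heatSymbol r ξ : ℂ)) z = heatKernel r z := by
  have hb : 0 < ((4 * Real.pi ^ 2 * r : ℝ) : ℂ).re := by
    rw [Complex.ofReal_re]; positivity
  have h := fourier_gaussian_innerProductSpace (V := Plane) hb z
  have h1 : (fun ξ => (heatSymbol r ξ : ℂ)) =
      fun ξ : Plane => Complex.exp (-((4 * Real.pi ^ 2 * r : ℝ) : ℂ) * (‖ξ‖ : ℂ) ^ 2) := by
    funext ξ
    rw [heatSymbol]
    push_cast
    congr 1
    ring
  have hpi : (Real.pi : ℂ) ≠ 0 := by exact_mod_cast Real.pi_ne_zero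
  have hr' : (r : ℂ) ≠ 0 := by exact_mod_cast hr.ne'
  rw [h1, h, heatKernel]
  simp only [finrank_euclideanSpace, Fintype.card_fin]
  push_cast
  rw [div_self (two_ne_zero' ℂ), Complex.cpow_one]
  congr 1
  · field_simp
  · congr 1
    field_simp

lemma integrable_heatSymbol {r : ℝ} (hr : 0 < r) : Integrable (heatSymbol r) := by
  have hb : 0 < ((4 * Real.pi ^ 2 * r : ℝ) : ℂ).re := by
    rw [Complex.ofReal_re]; positivity
  have h := (GaussianFourier.integrable_cexp_neg_mul_sq_norm_add (V := Plane) hb 0 0).norm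
  refine h.congr (.of_forall fun ξ => ?_)
  simp only [heatSymbol, Complex.norm_exp]
  congr 1
  norm_cast
  simp

lemma one_add_norm_mul_heatSymbol_le {r : ℝ} (hr : 0 < r) (ξ : Plane) :
    (1 + ‖ξ‖) * heatSymbol r ξ ≤ (1 + 1 / (8 * Real.pi ^ 2 * r)) * heatSymbol (r / 2) ξ := by
  set a := 2 * Real.pi ^ 2 * r with ha
  have ha0 : 0 < a := by positivity
  have h1 : heatSymbol r ξ = Real.exp (-(a * ‖ξ‖ ^ 2)) * heatSymbol (r / 2) ξ := by
    rw [heatSymbol, heatSymbol, ← Real.exp_add]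
    congr 1
    rw [ha]
    ring
  have h2 : 1 + ‖ξ‖ ≤ (1 + 1 / (4 * a)) * Real.exp (a * ‖ξ‖ ^ 2) := by
    have h3 := Real.add_one_le_exp (a * ‖ξ‖ ^ 2)
    have h4 : ‖ξ‖ ≤ 1 / (4 * a) + a * ‖ξ‖ ^ 2 := by
      have h5 : 1 / (4 * a) + a * ‖ξ‖ ^ 2 - ‖ξ‖ = (2 * a * ‖ξ‖ - 1) ^ 2 / (4 * a) := by
        field_simp
        ring
      have h6 : 0 ≤ (2 * a * ‖ξ‖ - 1) ^ 2 / (4 * a) := by positivity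
      linarith
    have h7 : 0 ≤ 1 / (4 * a) := by positivity
    have h8 : 0 ≤ a * ‖ξ‖ ^ 2 := by positivity
    nlinarith [mul_nonneg h7 h8, mul_le_mul_of_nonneg_left h3 (by linarith : 0 ≤ 1 + 1 / (4 * a))]
  have h9 : 8 * Real.pi ^ 2 * r = 4 * a := by rw [ha]; ring
  rw [h1, h9, ← mul_assoc]
  refine mul_le_mul_of_nonneg_right ?_ (heatSymbol_pos _ _).le
  calc _ ≤ (1 + 1 / (4 * a)) * Real.exp (a * ‖ξ‖ ^ 2) * Real.exp (-(a * ‖ξ‖ ^ 2)) := by gcongr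
    _ = _ := by rw [mul_assoc, ← Real.exp_add]; simp

lemma integrable_heatSymbol_mul {r : ℝ} (hr : 0 < r) {m : Plane → ℂ} (hm : Continuous m)
    {C : ℝ} (hC : ∀ ξ, ‖m ξ‖ ≤ C * (1 + ‖ξ‖)) :
    Integrable (fun ξ => (heatSymbol r ξ : ℂ) * m ξ) := by
  have hC0 : 0 ≤ C := by simpa using (norm_nonneg _).trans (hC 0)
  refine ((integrable_heatSymbol (half_pos hr)).const_mul
    (C * (1 + 1 / (8 * Real.pi ^ 2 * r)))).mono' ?_ (.of_forall fun ξ => ?_)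
  · have := continuous_heatSymbol
    exact (by fun_prop : Continuous fun ξ => (heatSymbol r ξ : ℂ) * m ξ).aestronglyMeasurable
  · rw [norm_mul, Complex.norm_real, Real.norm_of_nonneg (heatSymbol_pos r ξ).le]
    have h1 := mul_le_mul_of_nonneg_left (hC ξ) (heatSymbol_pos r ξ).le
    have h2 := mul_le_mul_of_nonneg_left (one_add_norm_mul_heatSymbol_le hr ξ) hC0
    linarith

/-- `e^{rΔ} F` is the inverse Fourier transform of the heat symbol times `𝓕 F`: move the transform
from `F` to the modulated Gaussian. -/
lemma ofReal_heat_eq {r : ℝ} (hr : 0 < r) {F : Plane → ℝ} (hF : Integrable F) (x : Plane) :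
    (heat r F x : ℂ) = 𝓕⁻ (fun ξ => (heatSymbol r ξ : ℂ) * 𝓕 (fun y => (F y : ℂ)) ξ) x := by
  have hg : Integrable (fun ξ => (heatSymbol r ξ : ℂ)) := by
    simpa using integrable_heatSymbol_mul hr (m := fun _ => 1) continuous_const (C := 1)
      (fun ξ => by simp)
  have hg' : Integrable (fun ξ => Real.fourierChar (inner ℝ ξ x) • (heatSymbol r ξ : ℂ)) := by
    have := (Real.fourierIntegral_convergent_iff (μ := volume) (-x)).2 hg
    simpa using this
  have h4 := VectorFourier.integral_fourierIntegral_smul_eq_flip (μ := volume) (ν := volume)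
    (L := innerₗ Plane) (f := fun y => (F y : ℂ))
    (g := fun ξ => Real.fourierChar (inner ℝ ξ x) • (heatSymbol r ξ : ℂ))
    Real.continuous_fourierChar continuous_inner hF.ofReal hg'
  rw [flip_innerₗ] at h4
  rw [Real.fourierInv_eq, heat, if_neg hr.ne', ← integral_complex_ofReal]
  refine Eq.trans ?_ (h4.symm.trans ?_)
  · refine integral_congr_ae (.of_forall fun y => ?_)
    change _ = (F y : ℂ) • 𝓕 (fun ξ => Real.fourierChar (inner ℝ ξ x) • (heatSymbol r ξ : ℂ)) y
    have hk : heatKernel r (x - y) = heatKernel r (y - x) := by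
      rw [heatKernel, heatKernel, norm_sub_rev]
    simp only [hk, Complex.ofReal_mul]
    rw [← fourier_heatSymbol hr, Real.fourier_eq, Real.fourier_eq, smul_eq_mul, mul_comm]
    congr 1
    refine integral_congr_ae (.of_forall fun ξ => ?_)
    simp only
    rw [← mul_smul, ← AddChar.map_add_eq_mul, inner_sub_right]
    congr 2
    ring
  · refine integral_congr_ae (.of_forall fun ξ => ?_)
    change 𝓕 (fun y => (F y : ℂ)) ξ • _ = _
    simp only [Circle.smul_def, smul_eq_mul]
    ring

lemma continuous_fourier_ofReal {F : Plane → ℝ} (hF : Integrable F) :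
    Continuous (𝓕 (fun y => (F y : ℂ))) :=
  VectorFourier.fourierIntegral_continuous Real.continuous_fourierChar continuous_inner hF.ofReal

lemma norm_fourier_ofReal_le (F : Plane → ℝ) (ξ : Plane) :
    ‖𝓕 (fun y => (F y : ℂ)) ξ‖ ≤ ∫ x, ‖F x‖ := by
  refine (VectorFourier.norm_fourierIntegral_le_integral_norm _ _ _ _ _).trans (le_of_eq ?_)
  simp

lemma continuous_partialSymbol (k : Fin 2) : Continuous (partialSymbol k) := by
  unfold partialSymbol
  fun_prop

lemma norm_partialSymbol_le (k : Fin 2) (ξ : Plane) : ‖partialSymbol k ξ‖ ≤ 2 * Real.pi * ‖ξ‖ := by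
  rw [norm_partialSymbol]
  have h := PiLp.norm_apply_le ξ k
  rw [Real.norm_eq_abs] at h
  have := Real.pi_pos
  gcongr

lemma integrable_partialSymbol_mul {r : ℝ} (hr : 0 < r) {F : Plane → ℝ} (hF : Integrable F)
    (k : Fin 2) : Integrable (fun ξ => (heatSymbol r ξ : ℂ) *
      (partialSymbol k ξ * 𝓕 (fun y => (F y : ℂ)) ξ)) := by
  refine integrable_heatSymbol_mul hr (C := 2 * Real.pi * ∫ x, ‖F x‖)
    ((continuous_partialSymbol k).mul (continuous_fourier_ofReal hF)) fun ξ => ?_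
  have h0 : 0 ≤ ∫ x, ‖F x‖ := integral_nonneg fun x => norm_nonneg _
  have hpi := Real.pi_pos
  rw [norm_mul]
  calc _ ≤ (2 * Real.pi * ‖ξ‖) * ∫ x, ‖F x‖ := by
        gcongr
        · exact norm_partialSymbol_le k ξ
        · exact norm_fourier_ofReal_le F ξ
    _ = 2 * Real.pi * (∫ x, ‖F x‖) * ‖ξ‖ := by ring
    _ ≤ _ := by gcongr; linarith

lemma ofReal_lineDeriv_heat_eq {r : ℝ} (hr : 0 < r) {F : Plane → ℝ} (hF : Integrable F)
    (k : Fin 2) (x : Plane) :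
    ((lineDeriv ℝ (heat r F) x (EuclideanSpace.single k 1) : ℝ) : ℂ) =
      𝓕⁻ (fun ξ => (heatSymbol r ξ : ℂ) * (partialSymbol k ξ * 𝓕 (fun y => (F y : ℂ)) ξ)) x := by
  set m : Plane → ℂ := 𝓕 (fun y => (F y : ℂ)) with hm
  set H : Plane → ℂ := fun ξ => (heatSymbol r ξ : ℂ) * m ξ with hH
  have h0 : 0 ≤ ∫ x, ‖F x‖ := integral_nonneg fun x => norm_nonneg _
  have hint : Integrable H := integrable_heatSymbol_mul hr (continuous_fourier_ofReal hF)
    (C := ∫ x, ‖F x‖) fun ξ => (norm_fourier_ofReal_le F ξ).trans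
      (le_mul_of_one_le_right h0 (by linarith [norm_nonneg ξ]))
  have hint1 : Integrable (fun ξ => ‖ξ‖ * ‖H ξ‖) := by
    have h := (integrable_heatSymbol_mul hr (m := fun ξ => (‖ξ‖ : ℂ) * m ξ) (C := ∫ x, ‖F x‖)
      (by have := continuous_fourier_ofReal hF; fun_prop) (fun ξ => by
        rw [norm_mul, Complex.norm_real, norm_norm, mul_comm]
        refine mul_le_mul (norm_fourier_ofReal_le F ξ) ?_ (norm_nonneg _) h0
        linarith)).norm
    refine h.congr (.of_forall fun ξ => ?_)
    simp [hH, mul_left_comm]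
  have hd := Real.hasFDerivAt_fourier hint hint1 (-x)
  have hd' := (hd.comp x ((hasFDerivAt_id x).neg)).hasLineDerivAt (EuclideanSpace.single k 1)
  have heq : (𝓕 H ∘ fun y : Plane => -y) = fun y => (heat r F y : ℂ) := by
    funext y
    rw [ofReal_heat_eq hr hF, Real.fourierInv_eq_fourier_neg]
    rfl
  have hd2 : HasLineDerivAt ℝ (fun y => (heat r F y : ℂ)) _ x (EuclideanSpace.single k 1) :=
    heq ▸ hd'
  have hre : HasLineDerivAt ℝ (heat r F) _ x (EuclideanSpace.single k 1) :=
    Complex.reCLM.hasFDerivAt.comp_hasDerivAt (0 : ℝ) hd2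
  have hof : HasLineDerivAt ℝ (fun y => (heat r F y : ℂ)) _ x (EuclideanSpace.single k 1) :=
    Complex.ofRealCLM.hasFDerivAt.comp_hasDerivAt (0 : ℝ) hre
  rw [hre.lineDeriv]
  have hu := hof.unique hd2
  have hsm : Integrable (VectorFourier.fourierSMulRight (innerSL ℝ) H) := by
    refine (hint1.const_mul (2 * Real.pi * ‖innerSL ℝ (E := Plane)‖)).mono'
      hint.1.fourierSMulRight (.of_forall fun ξ => ?_)
    refine (VectorFourier.norm_fourierSMulRight_le _ _ _).trans (le_of_eq (by ring))
  refine hu.trans ?_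
  rw [ContinuousLinearMap.comp_apply, Real.fourier_continuousLinearMap_apply hsm,
    Real.fourierInv_eq_fourier_neg]
  refine congrArg (fun h : Plane → ℂ => 𝓕 h (-x)) (funext fun ξ => ?_)
  have hi : innerSL ℝ ξ (EuclideanSpace.single k 1) = ξ k := by
    rw [innerSL_apply_apply, EuclideanSpace.inner_single_right]
    simp
  simp [VectorFourier.fourierSMulRight_apply, hH, partialSymbol, hi]
  ring

lemma ofReal_divHeat_eq {r : ℝ} (hr : 0 < r) {F : Fin 2 → Plane → ℝ} (hF : ∀ k, Integrable (F k))
    (x : Plane) :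
    (divHeat r F x : ℂ) = 𝓕⁻ (fun ξ => (heatSymbol r ξ : ℂ) *
      ∑ k, partialSymbol k ξ * 𝓕 (fun y => (F k y : ℂ)) ξ) x := by
  rw [divHeat]
  push_cast
  simp_rw [ofReal_lineDeriv_heat_eq hr (hF _), Real.fourierInv_eq, Finset.mul_sum]
  rw [← integral_finsetSum]
  · simp only [Finset.smul_sum]
  · intro k _
    have := (Real.fourierIntegral_convergent_iff (μ := volume) (-x)).2
      (integrable_partialSymbol_mul hr (hF k) k)
    simpa using this

lemma integral_fourierInv_mul {H : Plane → ℂ} (hH : Integrable H) (φ : 𝓢(Plane, ℂ)) :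
    ∫ x, 𝓕⁻ H x * φ x = ∫ ξ, H ξ * (𝓕⁻ φ : 𝓢(Plane, ℂ)) ξ := by
  have h4 := VectorFourier.integral_fourierIntegral_smul_eq_flip (μ := volume) (ν := volume)
    (L := -innerₗ Plane) (f := H) (g := φ)
    Real.continuous_fourierChar (by exact continuous_inner.neg) hH φ.integrable
  have hflip : (-innerₗ Plane).flip = -innerₗ Plane := by
    ext x y
    simp [real_inner_comm]
  rw [hflip] at h4
  rw [SchwartzMap.fourierInv_coe]
  exact h4

lemma integral_divHeat_mul {r : ℝ} (hr : 0 < r) {F : Fin 2 → Plane → ℝ}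
    (hF : ∀ k, Integrable (F k)) (φ : 𝓢(Plane, ℂ)) :
    ∫ x, (divHeat r F x : ℂ) * φ x = ∫ ξ, ((heatSymbol r ξ : ℂ) *
      ∑ k, partialSymbol k ξ * 𝓕 (fun y => (F k y : ℂ)) ξ) * (𝓕⁻ φ : 𝓢(Plane, ℂ)) ξ := by
  simp_rw [ofReal_divHeat_eq hr hF]
  have hint : Integrable (fun ξ => (heatSymbol r ξ : ℂ) *
      ∑ k, partialSymbol k ξ * 𝓕 (fun y => (F k y : ℂ)) ξ) := by
    simp_rw [Finset.mul_sum]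
    exact integrable_finsetSum _ fun k _ => integrable_partialSymbol_mul hr (hF k) k
  exact integral_fourierInv_mul hint φ

/-! ### Duhamel's formula on the Fourier side -/

/-- The Fourier transform of the nonlinearity `∇ · (u f)` with `u = ∇^⊥ Λ⁻¹ f`. -/
noncomputable def divFluxHat (f : L2) (ξ : Plane) : ℂ := ∑ k, partialSymbol k ξ * fluxHat k f ξ

lemma continuous_divFluxHat : Continuous fun p : L2 × Plane => divFluxHat p.1 p.2 := by
  unfold divFluxHat
  refine continuous_finsetSum _ fun k _ => ?_
  exact ((continuous_partialSymbol k).comp continuous_snd).mul (continuous_fluxHat k)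

lemma exists_norm_divFluxHat_le : ∃ C : ℝ, ∀ f ξ, ‖divFluxHat f ξ‖ ≤ C * ‖f‖ ^ 2 * ‖ξ‖ := by
  obtain ⟨C, hC⟩ := exists_norm_fluxHat_le
  refine ⟨2 * (2 * Real.pi * C), fun f ξ => ?_⟩
  have h : ∀ k, ‖partialSymbol k ξ * fluxHat k f ξ‖ ≤ 2 * Real.pi * ‖ξ‖ * (C * ‖f‖ ^ 2) := by
    intro k
    rw [norm_mul]
    have := Real.pi_pos
    gcongr
    · exact norm_partialSymbol_le k ξ
    · exact hC k f ξ
  rw [divFluxHat]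
  refine (norm_sum_le_of_le _ fun k _ => h k).trans (le_of_eq ?_)
  rw [Finset.sum_const, Finset.card_univ, Fintype.card_fin]
  simp
  ring

/-- The Fourier transform of the Duhamel integral `∫₀ᵗ ∇ · e^{(t-s)Δ} (u θ)(s) ds`. -/
noncomputable def duhamelHat (θ : ℝ → L2) (t : ℝ) (ξ : Plane) : ℂ :=
  ∫ s in (0 : ℝ)..t, (heatSymbol (t - s) ξ : ℂ) * divFluxHat (θ s) ξ

section

variable {θ : ℝ → L2}

lemma continuous_duhamel_integrand (hθ : Continuous θ) (t : ℝ) : Continuous fun p : ℝ × Plane =>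
    (heatSymbol (t - p.1) p.2 : ℂ) * divFluxHat (θ p.1) p.2 := by
  have h1 : Continuous fun p : ℝ × Plane => heatSymbol (t - p.1) p.2 := by
    unfold heatSymbol
    fun_prop
  have h2 : Continuous fun p : ℝ × Plane => divFluxHat (θ p.1) p.2 :=
    continuous_divFluxHat.comp₂ (hθ.comp continuous_fst) continuous_snd
  exact (Complex.continuous_ofReal.comp h1).mul h2

lemma exists_norm_duhamel_integrand_le (hθ : Continuous θ) (t : ℝ) :
    ∃ C : ℝ, ∀ s ∈ Ioc 0 t, ∀ ξ,
      ‖(heatSymbol (t - s) ξ : ℂ) * divFluxHat (θ s) ξ‖ ≤ C * ‖ξ‖ := by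
  obtain ⟨C, hC⟩ := exists_norm_divFluxHat_le
  obtain ⟨M, hM⟩ := (isCompact_Icc (a := (0 : ℝ)) (b := t)).exists_bound_of_continuousOn
    (f := fun s => C * ‖θ s‖ ^ 2) (by fun_prop)
  refine ⟨M, fun s hs ξ => ?_⟩
  rw [norm_mul, Complex.norm_real, Real.norm_of_nonneg (heatSymbol_pos _ ξ).le]
  refine (mul_le_of_le_one_left (norm_nonneg _)
    (heatSymbol_le_one (by linarith [hs.2]) ξ)).trans ((hC _ ξ).trans ?_)
  gcongr
  exact (Real.le_norm_self _).trans (hM s (Ioc_subset_Icc_self hs))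

lemma continuous_duhamelHat (hθ : Continuous θ) (t : ℝ) : Continuous (duhamelHat θ t) := by
  refine intervalIntegral.continuous_parametric_intervalIntegral_of_continuous' ?_ 0 t
  exact (continuous_duhamel_integrand hθ t).comp continuous_swap

lemma exists_norm_duhamelHat_le (hθ : Continuous θ) {t : ℝ} (ht : 0 ≤ t) :
    ∃ C : ℝ, ∀ ξ, ‖duhamelHat θ t ξ‖ ≤ C * ‖ξ‖ := by
  obtain ⟨C, hC⟩ := exists_norm_duhamel_integrand_le hθ t
  refine ⟨C * t, fun ξ => ?_⟩
  refine (intervalIntegral.norm_integral_le_of_norm_le_const (C := C * ‖ξ‖) ?_).trans (le_of_eq ?_)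
  · intro s hs
    rw [uIoc_of_le ht] at hs
    exact hC s hs ξ
  · rw [sub_zero, abs_of_nonneg ht]
    ring

lemma integral_divHeat_flux_eq (hθ : Continuous θ) {t : ℝ} (ht : 0 ≤ t) (φ : 𝓢(Plane, ℂ)) :
    ∫ s in (0 : ℝ)..t, ∫ x, (divHeat (t - s) (flux (θ s)) x : ℂ) * φ x =
      ∫ ξ, duhamelHat θ t ξ * (𝓕⁻ φ : 𝓢(Plane, ℂ)) ξ := by
  set ψ : 𝓢(Plane, ℂ) := 𝓕⁻ φ with hψ
  obtain ⟨C, hC⟩ := exists_norm_duhamel_integrand_le hθ t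
  have hint : Integrable (Function.uncurry fun (s : ℝ) (ξ : Plane) =>
      (heatSymbol (t - s) ξ : ℂ) * divFluxHat (θ s) ξ * ψ ξ)
      ((volume.restrict (Ioc 0 t)).prod volume) := by
    have hb := (integrable_const (μ := volume.restrict (Ioc 0 t)) C).mul_prod
      (ψ.integrable_pow_mul volume 1)
    refine hb.mono' ?_ ?_
    · exact ((continuous_duhamel_integrand hθ t).mul
        (ψ.continuous.comp continuous_snd)).aestronglyMeasurable
    · rw [Measure.restrict_prod_eq_prod_univ]
      refine (ae_restrict_iff' (measurableSet_Ioc.prod MeasurableSet.univ)).2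
        (.of_forall fun p hp => ?_)
      simp only [Function.uncurry]
      rw [norm_mul, pow_one, ← mul_assoc]
      gcongr
      exact hC p.1 hp.1 p.2
  calc ∫ s in (0 : ℝ)..t, ∫ x, (divHeat (t - s) (flux (θ s)) x : ℂ) * φ x
      = ∫ s in Ioc 0 t, ∫ ξ, (heatSymbol (t - s) ξ : ℂ) * divFluxHat (θ s) ξ * ψ ξ := by
        rw [intervalIntegral.integral_of_le ht]
        refine integral_congr_ae ?_
        filter_upwards [ae_restrict_mem measurableSet_Ioc,
          ae_restrict_of_ae (Measure.ae_ne volume t)] with s hs hne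
        -- At `s = t` the heat semigroup is the identity, and the Fourier formula fails.
        have hr : 0 < t - s := by
          rcases lt_or_eq_of_le hs.2 with h | h
          · linarith
          · exact absurd h hne
        exact integral_divHeat_mul hr (fun k => integrable_flux k (θ s)) φ
    _ = ∫ ξ, ∫ s in Ioc 0 t, (heatSymbol (t - s) ξ : ℂ) * divFluxHat (θ s) ξ * ψ ξ :=
        integral_integral_swap hint
    _ = _ := by
        refine integral_congr_ae (.of_forall fun ξ => ?_)
        simp only
        rw [integral_mul_const, duhamelHat, intervalIntegral.integral_of_le ht]

/-- A Schwartz function, regarded as complex-valued. -/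
noncomputable def complexifySchwartz : 𝓢(Plane, ℝ) →L[ℝ] 𝓢(Plane, ℂ) :=
  SchwartzMap.postcompCLM Complex.ofRealCLM

lemma complexifySchwartz_apply (φ : 𝓢(Plane, ℝ)) (x : Plane) :
    complexifySchwartz φ x = (φ x : ℂ) := rfl

lemma IsMildSolution.fourier_duhamel {T : ℝ} {θ₀ : L2} (h : IsMildSolution T θ₀ θ)
    (hθ : Continuous θ) {t : ℝ} (ht : t ∈ Icc 0 T) (φ : 𝓢(Plane, ℝ)) :
    ∫ ξ, (𝓕 (complexify (θ t)) : L2C) ξ * (𝓕⁻ (complexifySchwartz φ) : 𝓢(Plane, ℂ)) ξ =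
      ((∫ x, heat t θ₀ x * φ x : ℝ) : ℂ) -
        ∫ ξ, duhamelHat θ t ξ * (𝓕⁻ (complexifySchwartz φ) : 𝓢(Plane, ℂ)) ξ := by
  rw [← integral_mul_schwartz, ← integral_divHeat_flux_eq hθ ht.1]
  have h1 := congrArg (fun r : ℝ => (r : ℂ)) (h.duhamel t ht φ)
  simp only [Complex.ofReal_sub] at h1
  rw [← intervalIntegral.integral_ofReal, ← integral_complex_ofReal] at h1
  simp_rw [← integral_complex_ofReal (f := fun x => divHeat _ _ x * φ x)] at h1
  simp only [Complex.ofReal_mul] at h1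
  refine Eq.trans ?_ h1
  refine integral_congr_ae ?_
  filter_upwards [coeFn_complexify (θ t)] with x hx
  rw [hx, complexifySchwartz_apply]

end

/-- Real Schwartz functions suffice to test a complex function on the Fourier side, because every
complex Schwartz function is a complex combination of two real ones. -/
lemma ae_eq_zero_of_forall_real_schwartz {u : Plane → ℂ} (hu : LocallyIntegrable u)
    (hint : ∀ ψ : 𝓢(Plane, ℂ), Integrable (fun ξ => u ξ * ψ ξ))
    (h : ∀ φ : 𝓢(Plane, ℝ), ∫ ξ, u ξ * (𝓕⁻ (complexifySchwartz φ) : 𝓢(Plane, ℂ)) ξ = 0) :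
    ∀ᵐ ξ, u ξ = 0 := by
  have hC : ∀ φ : 𝓢(Plane, ℂ), ∫ ξ, u ξ * (𝓕⁻ φ : 𝓢(Plane, ℂ)) ξ = 0 := by
    intro φ
    set a : 𝓢(Plane, ℂ) := complexifySchwartz (SchwartzMap.postcompCLM Complex.reCLM φ) with ha
    set b : 𝓢(Plane, ℂ) := complexifySchwartz (SchwartzMap.postcompCLM Complex.imCLM φ) with hb
    have hφ : φ = a + Complex.I • b := by
      ext x
      have h1 : a x = ((φ x).re : ℂ) := rfl
      have h2 : b x = ((φ x).im : ℂ) := rfl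
      rw [add_apply, smul_apply, h1, h2, smul_eq_mul, mul_comm]
      exact (Complex.re_add_im _).symm
    have hinv : (𝓕⁻ φ : 𝓢(Plane, ℂ)) = 𝓕⁻ a + Complex.I • 𝓕⁻ b := by
      rw [hφ, FourierTransform.fourierInv_add, FourierTransform.fourierInv_smul]
    have hpt : ∀ ξ, u ξ * (𝓕⁻ φ : 𝓢(Plane, ℂ)) ξ = u ξ * (𝓕⁻ a : 𝓢(Plane, ℂ)) ξ +
        Complex.I * (u ξ * (𝓕⁻ b : 𝓢(Plane, ℂ)) ξ) := by
      intro ξ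
      rw [hinv, add_apply, smul_apply, smul_eq_mul]
      ring
    simp_rw [hpt]
    rw [integral_add (hint _) ((hint _).const_mul _), integral_const_mul, h, h]
    simp
  refine ae_eq_of_integral_contDiff_smul_eq hu (locallyIntegrable_zero (μ := volume))
    fun g hg hgc => ?_
  have hgc' : HasCompactSupport (fun x => (g x : ℂ)) :=
    hgc.comp_left (g := fun r : ℝ => (r : ℂ)) Complex.ofReal_zero
  have hg' : ContDiff ℝ (⊤ : ℕ∞) (fun x => (g x : ℂ)) := Complex.ofRealCLM.contDiff.comp hg
  have h1 := hC (𝓕 (hgc'.toSchwartzMap hg'))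
  rw [FourierTransform.fourierInv_fourier_eq] at h1
  simp only [smul_zero, integral_zero]
  refine Eq.trans (integral_congr_ae (.of_forall fun ξ => ?_)) h1
  simp [mul_comm]

/-- Two mild solutions with the same datum: their difference is, on the Fourier side, given by the
difference of the Duhamel integrals at almost every frequency. -/
lemma fourier_sub_ae_eq {T : ℝ} {θ₀ : L2} {θ θ' : ℝ → L2} (h : IsMildSolution T θ₀ θ)
    (h' : IsMildSolution T θ₀ θ') (hθ : Continuous θ) (hθ' : Continuous θ') {t : ℝ}
    (ht : t ∈ Icc 0 T) :
    (𝓕 (complexify (θ t - θ' t)) : L2C) =ᵐ[volume]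
      fun ξ => duhamelHat θ' t ξ - duhamelHat θ t ξ := by
  have hL : ∀ (f : L2C) (ψ : 𝓢(Plane, ℂ)), Integrable (fun ξ => f ξ * ψ ξ) := fun f ψ =>
    MemLp.integrable_mul (Lp.memLp f) (ψ.memLp 2 volume)
  have hD : ∀ {θ : ℝ → L2}, Continuous θ → ∀ ψ : 𝓢(Plane, ℂ),
      Integrable (fun ξ => duhamelHat θ t ξ * ψ ξ) := by
    intro θ hθ ψ
    obtain ⟨C, hC⟩ := exists_norm_duhamelHat_le hθ ht.1
    refine ((ψ.integrable_pow_mul volume 1).const_mul C).mono'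
      ((continuous_duhamelHat hθ t).mul ψ.continuous).aestronglyMeasurable
      (.of_forall fun ξ => ?_)
    rw [norm_mul, pow_one, ← mul_assoc]
    gcongr
    exact hC ξ
  set f : L2C := 𝓕 (complexify (θ t)) with hf
  set f' : L2C := 𝓕 (complexify (θ' t)) with hf'
  have hz : ∀ᵐ ξ, (f ξ - f' ξ) + (duhamelHat θ t ξ - duhamelHat θ' t ξ) = 0 := by
    refine ae_eq_zero_of_forall_real_schwartz ?_ ?_ ?_
    · refine LocallyIntegrable.add (LocallyIntegrable.sub ?_ ?_) ?_
      · exact (Lp.memLp f).locallyIntegrable (by norm_num)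
      · exact (Lp.memLp f').locallyIntegrable (by norm_num)
      · exact ((continuous_duhamelHat hθ t).sub (continuous_duhamelHat hθ' t)).locallyIntegrable
    · intro ψ
      simp_rw [add_mul, sub_mul]
      exact ((hL f ψ).sub (hL f' ψ)).add ((hD hθ ψ).sub (hD hθ' ψ))
    · intro φ
      have e1 := h.fourier_duhamel hθ ht φ
      have e2 := h'.fourier_duhamel hθ' ht φ
      rw [← hf] at e1
      rw [← hf'] at e2
      generalize (𝓕⁻ (complexifySchwartz φ) : 𝓢(Plane, ℂ)) = ψ at e1 e2 ⊢
      simp_rw [add_mul, sub_mul]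
      have hadd := integral_add ((hL f ψ).sub (hL f' ψ)) ((hD hθ ψ).sub (hD hθ' ψ))
      simp only [Pi.sub_apply] at hadd
      rw [hadd, integral_sub (hL f ψ) (hL f' ψ), integral_sub (hD hθ ψ) (hD hθ' ψ), e1, e2]
      ring
  have hs : (𝓕 (complexify (θ t - θ' t)) : L2C) = f - f' := by
    rw [complexify_sub, fourier_sub_L2C]
  rw [hs]
  filter_upwards [hz, Lp.coeFn_sub f f'] with ξ h1 h2
  rw [h2, Pi.sub_apply]
  linear_combination h1

/-! ### The symmetrized symbol of the nonlinearity -/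

/-- The symbol of the bilinear map `(f, g) ↦ ∇ · (g ∇^⊥ Λ⁻¹ f)` at output frequency `ξ`, with `f`
at frequency `η` and `g` at frequency `ξ - η`. -/
noncomputable def bilinSymbol (ξ η : Plane) : ℂ := ∑ k, partialSymbol k ξ * velocitySymbol k η

/-- The cross product of two plane vectors. -/
def cross (ξ η : Plane) : ℝ := ξ 0 * η 1 - ξ 1 * η 0

lemma abs_cross_le (ξ η : Plane) : |cross ξ η| ≤ ‖ξ‖ * ‖η‖ := by
  refine abs_le_of_sq_le_sq ?_ (by positivity)
  rw [mul_pow, EuclideanSpace.norm_sq_eq, EuclideanSpace.norm_sq_eq]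
  simp only [Fin.sum_univ_two, Real.norm_eq_abs, sq_abs, cross]
  nlinarith [sq_nonneg (ξ 0 * η 0 + ξ 1 * η 1)]

lemma cross_sub_right (ξ η : Plane) : cross ξ (ξ - η) = -cross ξ η := by
  simp [cross]
  ring

lemma bilinSymbol_eq (ξ η : Plane) :
    bilinSymbol ξ η = ((2 * Real.pi * (cross ξ η / ‖η‖) : ℝ) : ℂ) := by
  have hpi : (Real.pi : ℂ) ≠ 0 := by exact_mod_cast Real.pi_ne_zero
  simp only [bilinSymbol, Fin.sum_univ_two, velocitySymbol, perpGradSymbol, partialSymbol,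
    lambdaSymbol, cross]
  push_cast
  rcases eq_or_ne η 0 with rfl | hη
  · simp
  have hη' : (‖η‖ : ℂ) ≠ 0 := by exact_mod_cast (norm_ne_zero_iff.2 hη)
  field_simp
  linear_combination (ξ 1 * η 0 - ξ 0 * η 1 : ℂ) * Complex.I_sq

lemma norm_bilinSymbol_le (ξ η : Plane) : ‖bilinSymbol ξ η‖ ≤ 2 * Real.pi * ‖ξ‖ := by
  rw [bilinSymbol_eq, Complex.norm_real, norm_mul, norm_div, norm_norm,
    Real.norm_of_nonneg Real.two_pi_pos.le, Real.norm_eq_abs]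
  have := Real.pi_pos
  gcongr
  exact div_le_of_le_mul₀ (norm_nonneg _) (norm_nonneg _) (abs_cross_le ξ η)

lemma norm_bilinSymbol_add_le (ξ η : Plane) :
    ‖bilinSymbol ξ η + bilinSymbol ξ (ξ - η)‖ ≤ 4 * Real.pi * ‖ξ‖ := by
  refine (norm_add_le _ _).trans ?_
  linarith [norm_bilinSymbol_le ξ η, norm_bilinSymbol_le ξ (ξ - η)]

/-- The cancellation of the nonlinearity: symmetrizing in the two input frequencies replaces
`1 / |η|` by `1 / |η| - 1 / |ξ - η|`, which gains a factor `|ξ| / max (|η|, |ξ - η|)`. -/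
lemma norm_bilinSymbol_add_mul_le (ξ η : Plane) :
    ‖bilinSymbol ξ η + bilinSymbol ξ (ξ - η)‖ * max ‖η‖ ‖ξ - η‖ ≤ 2 * Real.pi * ‖ξ‖ ^ 2 := by
  have hpi := Real.pi_pos
  rcases eq_or_ne η 0 with rfl | hη
  · have h : bilinSymbol ξ 0 + bilinSymbol ξ (ξ - 0) = 0 := by
      simp [bilinSymbol_eq, cross, mul_comm]
    rw [h, norm_zero, zero_mul]
    positivity
  rcases eq_or_ne (ξ - η) 0 with hζ | hζ
  · obtain rfl := sub_eq_zero.1 hζ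
    have h : bilinSymbol ξ ξ + bilinSymbol ξ (ξ - ξ) = 0 := by
      simp [bilinSymbol_eq, cross, mul_comm]
    rw [h, norm_zero, zero_mul]
    positivity
  have hη' : 0 < ‖η‖ := norm_pos_iff.2 hη
  have hζ' : 0 < ‖ξ - η‖ := norm_pos_iff.2 hζ
  have h1 : bilinSymbol ξ η + bilinSymbol ξ (ξ - η) =
      ((2 * Real.pi * (cross ξ η * (‖ξ - η‖ - ‖η‖) / (‖η‖ * ‖ξ - η‖)) : ℝ) : ℂ) := by
    rw [bilinSymbol_eq, bilinSymbol_eq, cross_sub_right, ← Complex.ofReal_add]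
    congr 1
    field_simp
    ring
  have h2 : |‖ξ - η‖ - ‖η‖| ≤ ‖ξ‖ := by
    have h := abs_norm_sub_norm_le (ξ - η) (-η)
    rwa [norm_neg, sub_neg_eq_add, sub_add_cancel] at h
  have h3 : |cross ξ η| * max ‖η‖ ‖ξ - η‖ ≤ ‖ξ‖ * (‖η‖ * ‖ξ - η‖) := by
    rcases le_total ‖η‖ ‖ξ - η‖ with h | h
    · rw [max_eq_right h, ← mul_assoc]
      gcongr
      exact abs_cross_le ξ η
    · rw [max_eq_left h, mul_comm ‖η‖, ← mul_assoc]
      have := abs_cross_le ξ (ξ - η)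
      rw [cross_sub_right, abs_neg] at this
      gcongr
  rw [h1, Complex.norm_real, norm_mul (2 * Real.pi) _, Real.norm_of_nonneg Real.two_pi_pos.le,
    Real.norm_eq_abs, abs_div, abs_mul, abs_of_pos (mul_pos hη' hζ'), mul_assoc]
  gcongr
  rw [div_mul_eq_mul_div, div_le_iff₀ (by positivity)]
  calc |cross ξ η| * |‖ξ - η‖ - ‖η‖| * max ‖η‖ ‖ξ - η‖
      = |‖ξ - η‖ - ‖η‖| * (|cross ξ η| * max ‖η‖ ‖ξ - η‖) := by ring
    _ ≤ ‖ξ‖ * (‖ξ‖ * (‖η‖ * ‖ξ - η‖)) := by gcongr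
    _ = _ := by ring

lemma enorm_bilinSymbol_add_le_highKernel (ξ η : Plane) :
    ‖bilinSymbol ξ η + bilinSymbol ξ (ξ - η)‖ₑ ≤
      ENNReal.ofReal (2 * Real.pi) * ‖ξ‖ₑ ^ 2 * highKernel η (ξ - η) := by
  rcases eq_or_ne (max ‖η‖ₑ ‖ξ - η‖ₑ) 0 with h0 | h0
  · have hη : η = 0 := by simpa using (le_max_left ‖η‖ₑ ‖ξ - η‖ₑ).trans_eq h0
    have hζ : ξ - η = 0 := by simpa using (le_max_right ‖η‖ₑ ‖ξ - η‖ₑ).trans_eq h0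
    have hξ : ξ = 0 := by rw [← sub_add_cancel ξ η, hζ, hη, add_zero]
    have := norm_bilinSymbol_add_le ξ η
    rw [hξ, norm_zero, mul_zero, norm_le_zero_iff] at this
    rw [hξ, this]
    simp
  · rw [highKernel, ← div_eq_mul_inv, ENNReal.le_div_iff_mul_le (.inl h0) (.inl (by simp))]
    have h := ENNReal.ofReal_le_ofReal (norm_bilinSymbol_add_mul_le ξ η)
    rw [ENNReal.ofReal_mul (norm_nonneg _), ENNReal.ofReal_mul Real.two_pi_pos.le,
      ENNReal.ofReal_pow (norm_nonneg _), ENNReal.ofReal_max] at h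
    simpa only [ofReal_norm] using h

lemma enorm_bilinSymbol_add_le (ξ η : Plane) :
    ‖bilinSymbol ξ η + bilinSymbol ξ (ξ - η)‖ₑ ≤ ENNReal.ofReal (4 * Real.pi) * ‖ξ‖ₑ := by
  have h := ENNReal.ofReal_le_ofReal (norm_bilinSymbol_add_le ξ η)
  rw [ENNReal.ofReal_mul (by positivity)] at h
  simpa only [ofReal_norm] using h

lemma integrable_conv_L2C (f g : L2C) (ξ : Plane) : Integrable (fun η => f η * g (ξ - η)) :=
  MemLp.integrable_mul (Lp.memLp f)
    ((Lp.memLp g).comp_measurePreserving (Measure.measurePreserving_sub_left volume ξ))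

lemma measurable_bilinSymbol (ξ : Plane) : Measurable (bilinSymbol ξ) := by
  have := measurable_velocitySymbol
  unfold bilinSymbol
  fun_prop

lemma integrable_bilinSymbol_mul (f g : L2C) (ξ : Plane) :
    Integrable (fun η => bilinSymbol ξ η * (f η * g (ξ - η))) :=
  (integrable_conv_L2C f g ξ).bdd_mul (measurable_bilinSymbol ξ).aestronglyMeasurable
    (.of_forall fun η => norm_bilinSymbol_le ξ η)

lemma divFluxHat_eq (f : L2) (ξ : Plane) : divFluxHat f ξ = ∫ η, bilinSymbol ξ η *
    ((𝓕 (complexify f) : L2C) η * (𝓕 (complexify f) : L2C) (ξ - η)) := by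
  simp_rw [divFluxHat, fluxHat_eq, bilinSymbol, Finset.sum_mul, ← integral_const_mul]
  rw [← integral_finsetSum]
  · simp only [mul_assoc]
  · intro k _
    refine Integrable.const_mul ?_ _
    exact (integrable_conv_L2C _ _ ξ).bdd_mul (measurable_velocitySymbol k).aestronglyMeasurable
      (.of_forall fun η => norm_velocitySymbol_le k η)

/-- Polarization of the quadratic nonlinearity, with symmetrized symbol. -/
lemma two_mul_divFluxHat_sub (f f' : L2) (ξ : Plane) :
    2 * (divFluxHat f ξ - divFluxHat f' ξ) =
      ∫ η, (bilinSymbol ξ η + bilinSymbol ξ (ξ - η)) *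
        ((𝓕 (complexify (f - f')) : L2C) η * (𝓕 (complexify (f + f')) : L2C) (ξ - η)) := by
  set F : L2C := 𝓕 (complexify f) with hF
  set F' : L2C := 𝓕 (complexify f') with hF'
  set W : L2C := 𝓕 (complexify (f - f')) with hW
  set P : L2C := 𝓕 (complexify (f + f')) with hP
  have hWe : ∀ᵐ η, W η = F η - F' η := by
    have h : W = F - F' := by rw [hW, complexify_sub, fourier_sub_L2C]
    rw [h]
    exact Lp.coeFn_sub F F'
  have hPe : ∀ᵐ η, P η = F η + F' η := by
    have h : P = F + F' := by rw [hP, complexify_add, fourier_add_L2C]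
    rw [h]
    exact Lp.coeFn_add F F'
  have hq := (Measure.measurePreserving_sub_left (volume : Measure Plane) ξ).quasiMeasurePreserving
  have hI := integrable_bilinSymbol_mul W P ξ
  have hI' := integrable_bilinSymbol_mul P W ξ
  have hrefl : ∫ η, bilinSymbol ξ (ξ - η) * (W η * P (ξ - η)) =
      ∫ η, bilinSymbol ξ η * (P η * W (ξ - η)) := by
    rw [← integral_sub_left_eq_self _ volume ξ]
    refine integral_congr_ae (.of_forall fun η => ?_)
    simp only [sub_sub_cancel]
    ring
  have hI'' : Integrable (fun η => bilinSymbol ξ (ξ - η) * (W η * P (ξ - η))) := by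
    refine (hI'.comp_sub_left ξ).congr (.of_forall fun η => ?_)
    simp only [sub_sub_cancel]
    ring
  simp_rw [add_mul]
  rw [integral_add hI hI'', hrefl, ← integral_add hI hI', divFluxHat_eq, divFluxHat_eq,
    ← integral_sub (integrable_bilinSymbol_mul F F ξ) (integrable_bilinSymbol_mul F' F' ξ),
    ← integral_const_mul]
  refine integral_congr_ae ?_
  filter_upwards [hWe, hPe, hq.ae hWe, hq.ae hPe] with η h1 h2 h3 h4
  rw [h1, h2, h3, h4]
  ring

/-- The bilinear form with the symmetrized symbol, where the part `g` of the second argument is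
treated with the crude bound on the symbol, the rest with the cancellation. -/
lemma lintegral_bilinSymbol_le {W P g : Plane → ℂ} (hW : Measurable W) (hP : Measurable P)
    (hg : Measurable g) (ξ : Plane) :
    ∫⁻ η, ‖(bilinSymbol ξ η + bilinSymbol ξ (ξ - η)) * (W η * P (ξ - η))‖ₑ ≤
      ENNReal.ofReal (2 * Real.pi) * ‖ξ‖ₑ ^ 2 *
        (∫⁻ η, ‖W η‖ₑ * ‖P (ξ - η) - g (ξ - η)‖ₑ * highKernel η (ξ - η)) +
      ENNReal.ofReal (4 * Real.pi) * ‖ξ‖ₑ * ∫⁻ η, ‖W η‖ₑ * ‖g (ξ - η)‖ₑ := by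
  have hK : Measurable fun η => highKernel η (ξ - η) := by
    unfold highKernel
    fun_prop
  calc ∫⁻ η, ‖(bilinSymbol ξ η + bilinSymbol ξ (ξ - η)) * (W η * P (ξ - η))‖ₑ
      ≤ ∫⁻ η, (ENNReal.ofReal (2 * Real.pi) * ‖ξ‖ₑ ^ 2 *
          (‖W η‖ₑ * ‖P (ξ - η) - g (ξ - η)‖ₑ * highKernel η (ξ - η)) +
          ENNReal.ofReal (4 * Real.pi) * ‖ξ‖ₑ * (‖W η‖ₑ * ‖g (ξ - η)‖ₑ)) := by
        refine lintegral_mono fun η => ?_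
        rw [enorm_mul, enorm_mul]
        have h3 : ‖P (ξ - η)‖ₑ ≤ ‖P (ξ - η) - g (ξ - η)‖ₑ + ‖g (ξ - η)‖ₑ := by
          simpa using enorm_add_le (P (ξ - η) - g (ξ - η)) (g (ξ - η))
        have h4 := enorm_bilinSymbol_add_le_highKernel ξ η
        have h5 := enorm_bilinSymbol_add_le ξ η
        generalize ‖bilinSymbol ξ η + bilinSymbol ξ (ξ - η)‖ₑ = S at h4 h5 ⊢
        calc _ ≤ S * (‖W η‖ₑ * (‖P (ξ - η) - g (ξ - η)‖ₑ + ‖g (ξ - η)‖ₑ)) := by gcongr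
          _ = S * (‖W η‖ₑ * ‖P (ξ - η) - g (ξ - η)‖ₑ) + S * (‖W η‖ₑ * ‖g (ξ - η)‖ₑ) := by ring
          _ ≤ (ENNReal.ofReal (2 * Real.pi) * ‖ξ‖ₑ ^ 2 * highKernel η (ξ - η)) *
              (‖W η‖ₑ * ‖P (ξ - η) - g (ξ - η)‖ₑ) +
              (ENNReal.ofReal (4 * Real.pi) * ‖ξ‖ₑ) * (‖W η‖ₑ * ‖g (ξ - η)‖ₑ) := by gcongr
          _ = _ := by ring
    _ = _ := by
        rw [lintegral_add_left (by fun_prop), lintegral_const_mul _ (by fun_prop),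
          lintegral_const_mul _ (by fun_prop)]

lemma enorm_divFluxHat_sub_le (f f' : L2) {g : Plane → ℂ} (hg : Measurable g) (ξ : Plane) :
    ‖divFluxHat f ξ - divFluxHat f' ξ‖ₑ ≤
      ENNReal.ofReal (2 * Real.pi) * ‖ξ‖ₑ ^ 2 *
        (∫⁻ η, ‖(𝓕 (complexify (f - f')) : L2C) η‖ₑ *
          ‖(𝓕 (complexify (f + f')) : L2C) (ξ - η) - g (ξ - η)‖ₑ * highKernel η (ξ - η)) +
      ENNReal.ofReal (4 * Real.pi) * ‖ξ‖ₑ *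
        ∫⁻ η, ‖(𝓕 (complexify (f - f')) : L2C) η‖ₑ * ‖g (ξ - η)‖ₑ := by
  refine le_trans ?_ (lintegral_bilinSymbol_le (Lp.stronglyMeasurable _).measurable
    (Lp.stronglyMeasurable _).measurable hg ξ)
  calc ‖divFluxHat f ξ - divFluxHat f' ξ‖ₑ
      ≤ ‖2 * (divFluxHat f ξ - divFluxHat f' ξ)‖ₑ := by
        rw [enorm_mul]
        refine le_mul_of_one_le_left zero_le ?_
        rw [← ofReal_norm, Complex.norm_ofNat]
        norm_num
    _ ≤ _ := by
        rw [two_mul_divFluxHat_sub f f' ξ]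
        exact enorm_integral_le_lintegral_enorm _

/-! ### Maximal regularity and the contraction estimate -/

lemma sq_eLpNorm_two (f : Plane → ℂ) : eLpNorm f 2 volume ^ 2 = ∫⁻ ξ, ‖f ξ‖ₑ ^ 2 := by
  rw [eLpNorm_eq_lintegral_rpow_enorm_toReal (by norm_num) (by norm_num), ← ENNReal.rpow_natCast,
    ← ENNReal.rpow_mul]
  norm_num

lemma lintegral_sq_enorm_fourier_complexify (f : L2) :
    ∫⁻ ξ, ‖(𝓕 (complexify f) : L2C) ξ‖ₑ ^ 2 = ‖f‖ₑ ^ 2 := by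
  rw [← sq_eLpNorm_two, ← Lp.enorm_def, ← ofReal_norm, Lp.norm_fourier_eq, norm_complexify,
    ofReal_norm]

/-- The integral of the heat symbol over the time interval `[0, δ]`. -/
noncomputable def heatMass (δ : ℝ) (ξ : Plane) : ℝ≥0∞ :=
  ∫⁻ r in Icc 0 δ, ENNReal.ofReal (heatSymbol r ξ)

lemma measurable_heatMass (δ : ℝ) : Measurable (heatMass δ) := by
  refine Measurable.lintegral_prod_right' (ν := volume.restrict (Icc 0 δ))
    (f := fun p : Plane × ℝ => ENNReal.ofReal (heatSymbol p.2 p.1)) ?_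
  exact (continuous_heatSymbol.comp continuous_swap).measurable.ennreal_ofReal

lemma heatMass_le (δ : ℝ) (ξ : Plane) : heatMass δ ξ ≤ ENNReal.ofReal δ := by
  calc heatMass δ ξ ≤ ∫⁻ _ in Icc 0 δ, 1 := by
        refine setLIntegral_mono measurable_const fun r hr => ?_
        exact ENNReal.ofReal_le_one.2 (heatSymbol_le_one hr.1 ξ)
    _ = _ := by simp

lemma heatMass_mul_le (δ : ℝ) (ξ : Plane) : heatMass δ ξ * ‖ξ‖ₑ ^ 2 ≤ 1 := by
  rcases eq_or_ne ξ 0 with rfl | hξ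
  · simp
  have hξ' : 0 < ‖ξ‖ := norm_pos_iff.2 hξ
  have hA : 0 < ‖ξ‖ ^ 2 := by positivity
  have hle : ∀ r ∈ Ioi (0 : ℝ), heatSymbol r ξ ≤ Real.exp (-(‖ξ‖ ^ 2) * r) := by
    intro r hr
    rw [heatSymbol]
    refine Real.exp_le_exp.2 ?_
    have h1 : 1 ≤ 4 * Real.pi ^ 2 := by nlinarith [Real.pi_gt_three]
    have h2 : 0 ≤ r * ‖ξ‖ ^ 2 := mul_nonneg (le_of_lt hr) hA.le
    nlinarith
  have hI : IntegrableOn (fun r : ℝ => Real.exp (-(‖ξ‖ ^ 2) * r)) (Ioi 0) :=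
    integrableOn_exp_mul_Ioi (by linarith) 0
  have hmass : heatMass δ ξ ≤ ENNReal.ofReal (1 / ‖ξ‖ ^ 2) := by
    calc heatMass δ ξ ≤ ∫⁻ r in Ici (0 : ℝ), ENNReal.ofReal (heatSymbol r ξ) :=
          lintegral_mono_set Icc_subset_Ici_self
      _ = ∫⁻ r in Ioi (0 : ℝ), ENNReal.ofReal (heatSymbol r ξ) :=
          setLIntegral_congr Ioi_ae_eq_Ici.symm
      _ ≤ ∫⁻ r in Ioi (0 : ℝ), ENNReal.ofReal (Real.exp (-(‖ξ‖ ^ 2) * r)) :=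
          setLIntegral_mono (by fun_prop) fun r hr => ENNReal.ofReal_le_ofReal (hle r hr)
      _ = ENNReal.ofReal (1 / ‖ξ‖ ^ 2) := by
          rw [← ofReal_integral_eq_lintegral_ofReal hI (.of_forall fun r => (Real.exp_pos _).le),
            integral_exp_mul_Ioi (by linarith)]
          congr 1
          simp
  calc heatMass δ ξ * ‖ξ‖ₑ ^ 2 ≤ ENNReal.ofReal (1 / ‖ξ‖ ^ 2) * ‖ξ‖ₑ ^ 2 := by gcongr
    _ = 1 := by
      rw [← ofReal_norm, ← ENNReal.ofReal_pow (norm_nonneg _), ← ENNReal.ofReal_mul (by positivity),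
        one_div, inv_mul_cancel₀ hA.ne', ENNReal.ofReal_one]

/-- The contraction estimate at a fixed time, for a nonlinearity dominated by `D`. The first term
on the right comes from the scale-invariant bilinear estimate, the second one from Young's
inequality and `heatMass δ ξ * |ξ| ≤ √δ`. -/
lemma lintegral_sq_heatMass_mul_le_of_le (δ : ℝ) {W Q G D : Plane → ℝ≥0∞} (hW : Measurable W)
    (hQ : Measurable Q) (hG : Measurable G)
    (hD : ∀ ξ, D ξ ≤
      ENNReal.ofReal (2 * Real.pi) * ‖ξ‖ₑ ^ 2 * (∫⁻ η, W η * Q (ξ - η) * highKernel η (ξ - η)) +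
      ENNReal.ofReal (4 * Real.pi) * ‖ξ‖ₑ * ∫⁻ η, W η * G (ξ - η)) :
    ∫⁻ ξ, heatMass δ ξ ^ 2 * D ξ ^ 2 ≤
      (2048 * (∫⁻ ξ, Q ξ ^ 2) + 512 * ENNReal.ofReal δ * (∫⁻ ξ, G ξ) ^ 2) * ∫⁻ ξ, W ξ ^ 2 := by
  have hpi2 : ENNReal.ofReal (2 * Real.pi) ≤ 8 :=
    (ENNReal.ofReal_le_ofReal (by linarith [Real.pi_le_four] : 2 * Real.pi ≤ 8)).trans_eq (by simp)
  have hpi4 : ENNReal.ofReal (4 * Real.pi) ≤ 16 :=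
    (ENNReal.ofReal_le_ofReal (by linarith [Real.pi_le_four] : 4 * Real.pi ≤ 16)).trans_eq (by simp)
  have hpi : ENNReal.ofReal Real.pi ≤ 4 :=
    (ENNReal.ofReal_le_ofReal Real.pi_le_four).trans_eq (by simp)
  set I : Plane → ℝ≥0∞ := fun ξ => ∫⁻ η, W η * Q (ξ - η) * highKernel η (ξ - η) with hI
  set J : Plane → ℝ≥0∞ := fun ξ => ∫⁻ η, W η * G (ξ - η) with hJ
  have hJm : Measurable J := Measurable.lintegral_prod_right'
    (f := fun p : Plane × Plane => W p.2 * G (p.1 - p.2)) (by fun_prop)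
  have hpt : ∀ ξ, heatMass δ ξ ^ 2 * D ξ ^ 2 ≤
      128 * I ξ ^ 2 + 512 * ENNReal.ofReal δ * J ξ ^ 2 := by
    intro ξ
    have h1 := heatMass_mul_le δ ξ
    have h2 := heatMass_le δ ξ
    have h3 := hD ξ
    generalize heatMass δ ξ = κ at h1 h2 ⊢
    calc κ ^ 2 * D ξ ^ 2 ≤ κ ^ 2 * (8 * ‖ξ‖ₑ ^ 2 * I ξ + 16 * ‖ξ‖ₑ * J ξ) ^ 2 := by
          gcongr
          refine h3.trans ?_
          gcongr
      _ ≤ κ ^ 2 * (2 * ((8 * ‖ξ‖ₑ ^ 2 * I ξ) ^ 2 + (16 * ‖ξ‖ₑ * J ξ) ^ 2)) := by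
          gcongr
          exact add_sq_le_two_mul _ _
      _ = 128 * (κ * ‖ξ‖ₑ ^ 2) ^ 2 * I ξ ^ 2 + 512 * (κ * (κ * ‖ξ‖ₑ ^ 2)) * J ξ ^ 2 := by ring
      _ ≤ 128 * 1 ^ 2 * I ξ ^ 2 + 512 * (ENNReal.ofReal δ * 1) * J ξ ^ 2 := by gcongr
      _ = _ := by ring
  calc ∫⁻ ξ, heatMass δ ξ ^ 2 * D ξ ^ 2
      ≤ ∫⁻ ξ, (128 * I ξ ^ 2 + 512 * ENNReal.ofReal δ * J ξ ^ 2) := lintegral_mono hpt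
    _ = 128 * (∫⁻ ξ, I ξ ^ 2) + 512 * ENNReal.ofReal δ * ∫⁻ ξ, J ξ ^ 2 := by
        rw [lintegral_add_right _ (by fun_prop), lintegral_const_mul' _ _ (by simp),
          lintegral_const_mul _ (by fun_prop)]
    _ ≤ 128 * (4 * 4 * (∫⁻ ξ, W ξ ^ 2) * ∫⁻ ξ, Q ξ ^ 2) +
        512 * ENNReal.ofReal δ * ((∫⁻ ξ, G ξ) ^ 2 * ∫⁻ ξ, W ξ ^ 2) := by
        gcongr
        · refine (lintegral_sq_highKernel_le hW hQ).trans ?_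
          gcongr
        · exact lintegral_sq_conv_le volume hW hG
    _ = _ := by ring

lemma lintegral_sq_heatMass_mul_le (δ : ℝ) (f f' : L2) {g : Plane → ℂ} (hg : Measurable g) :
    ∫⁻ ξ, heatMass δ ξ ^ 2 * ‖divFluxHat f ξ - divFluxHat f' ξ‖ₑ ^ 2 ≤
      (2048 * eLpNorm (fun ξ => (𝓕 (complexify (f + f')) : L2C) ξ - g ξ) 2 volume ^ 2 +
        512 * ENNReal.ofReal δ * (∫⁻ ξ, ‖g ξ‖ₑ) ^ 2) * ‖f - f'‖ₑ ^ 2 := by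
  rw [sq_eLpNorm_two, ← lintegral_sq_enorm_fourier_complexify (f - f')]
  exact lintegral_sq_heatMass_mul_le_of_le δ (Lp.stronglyMeasurable _).measurable.enorm
    ((Lp.stronglyMeasurable _).measurable.sub hg).enorm hg.enorm
    (enorm_divFluxHat_sub_le f f' hg)

/-- Maximal regularity: Young's inequality in time, at each frequency. -/
lemma lintegral_sq_duhamel_le {m : ℝ → Plane → ℝ≥0∞}
    (hm : Measurable fun p : ℝ × Plane => m p.1 p.2) {a δ : ℝ} {E : ℝ → Plane → ℝ≥0∞}
    (hE : ∀ t ∈ Icc a (a + δ), ∀ᵐ ξ, E t ξ ≤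
      ∫⁻ s in Icc a t, m s ξ * ENNReal.ofReal (heatSymbol (t - s) ξ)) :
    ∫⁻ t in Icc a (a + δ), ∫⁻ ξ, E t ξ ^ 2 ≤
      ∫⁻ s in Icc a (a + δ), ∫⁻ ξ, heatMass δ ξ ^ 2 * m s ξ ^ 2 := by
  set h : Plane → ℝ → ℝ≥0∞ := fun ξ => (Icc a (a + δ)).indicator fun s => m s ξ with hh
  set k : Plane → ℝ → ℝ≥0∞ := fun ξ => (Icc 0 δ).indicator fun r => ENNReal.ofReal (heatSymbol r ξ)
    with hk
  have hheat : Measurable fun p : ℝ × Plane => heatSymbol p.1 p.2 :=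
    continuous_heatSymbol.measurable
  have hhm : Measurable fun p : Plane × ℝ => h p.1 p.2 := by
    have h1 : (fun p : Plane × ℝ => h p.1 p.2) =
        (Prod.snd ⁻¹' Icc a (a + δ)).indicator fun p : Plane × ℝ => m p.2 p.1 := by
      funext p
      simp [hh, indicator]
    rw [h1]
    exact (hm.comp measurable_swap).indicator (measurable_snd measurableSet_Icc)
  have hkm : Measurable fun p : Plane × ℝ => k p.1 p.2 := by
    have h1 : (fun p : Plane × ℝ => k p.1 p.2) =
        (Prod.snd ⁻¹' Icc 0 δ).indicator
          fun p : Plane × ℝ => ENNReal.ofReal (heatSymbol p.2 p.1) := by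
      funext p
      simp [hk, indicator]
    rw [h1]
    exact (hheat.comp measurable_swap).ennreal_ofReal.indicator (measurable_snd measurableSet_Icc)
  have hconv : Measurable fun p : ℝ × Plane => ∫⁻ s, h p.2 s * k p.2 (p.1 - s) := by
    refine Measurable.lintegral_prod_right'
      (f := fun q : (ℝ × Plane) × ℝ => h q.1.2 q.2 * k q.1.2 (q.1.1 - q.2)) ?_
    exact (hhm.comp (by fun_prop : Measurable fun q : (ℝ × Plane) × ℝ => (q.1.2, q.2))).mul
      (hkm.comp (by fun_prop : Measurable fun q : (ℝ × Plane) × ℝ => (q.1.2, q.1.1 - q.2)))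
  calc ∫⁻ t in Icc a (a + δ), ∫⁻ ξ, E t ξ ^ 2
      ≤ ∫⁻ t in Icc a (a + δ), ∫⁻ ξ, (∫⁻ s, h ξ s * k ξ (t - s)) ^ 2 := by
        refine setLIntegral_mono ?_ fun t ht => lintegral_mono_ae ?_
        · exact Measurable.lintegral_prod_right'
            (f := fun p : ℝ × Plane => (∫⁻ s, h p.2 s * k p.2 (p.1 - s)) ^ 2) (hconv.pow_const 2)
        · filter_upwards [hE t ht] with ξ hξ
          gcongr
          refine hξ.trans ((setLIntegral_mono' measurableSet_Icc fun s hs => ?_).trans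
            (setLIntegral_le_lintegral (Icc a t) fun s => h ξ s * k ξ (t - s)))
          have h1 : h ξ s = m s ξ :=
            indicator_of_mem (show s ∈ Icc a (a + δ) from ⟨hs.1, hs.2.trans ht.2⟩) _
          have h2 : k ξ (t - s) = ENNReal.ofReal (heatSymbol (t - s) ξ) :=
            indicator_of_mem
            (show t - s ∈ Icc 0 δ from ⟨by linarith [hs.2], by linarith [hs.1, ht.2]⟩) _
          rw [h1, h2]
    _ ≤ ∫⁻ t, ∫⁻ ξ, (∫⁻ s, h ξ s * k ξ (t - s)) ^ 2 := setLIntegral_le_lintegral _ _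
    _ = ∫⁻ ξ, ∫⁻ t, (∫⁻ s, h ξ s * k ξ (t - s)) ^ 2 :=
        lintegral_lintegral_swap (hconv.pow_const 2).aemeasurable
    _ ≤ ∫⁻ ξ, heatMass δ ξ ^ 2 * ∫⁻ s in Icc a (a + δ), m s ξ ^ 2 := by
        refine lintegral_mono fun ξ => ?_
        have hhξ : Measurable (h ξ) := hhm.comp (by fun_prop : Measurable fun s : ℝ => (ξ, s))
        have hkξ : Measurable (k ξ) := hkm.comp (by fun_prop : Measurable fun s : ℝ => (ξ, s))
        refine (lintegral_sq_conv_le volume hhξ hkξ).trans (le_of_eq ?_)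
        rw [hk, lintegral_indicator measurableSet_Icc, heatMass,
          ← lintegral_indicator measurableSet_Icc (fun s => m s ξ ^ 2)]
        congr 1
        refine lintegral_congr fun s => ?_
        by_cases hs : s ∈ Icc a (a + δ) <;> simp [hh, hs]
    _ = ∫⁻ ξ, ∫⁻ s in Icc a (a + δ), heatMass δ ξ ^ 2 * m s ξ ^ 2 := by
        refine lintegral_congr fun ξ => ?_
        rw [lintegral_const_mul]
        exact (hm.comp (by fun_prop : Measurable fun s : ℝ => (s, ξ))).pow_const 2
    _ = _ := by
        refine lintegral_lintegral_swap (Measurable.aemeasurable ?_)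
        exact (((measurable_heatMass δ).comp measurable_fst).pow_const 2).mul
          ((hm.comp measurable_swap).pow_const 2)

/-! ### Uniqueness -/

lemma eLpNorm_fourier_sub_le (f f₀ : L2) {g : Plane → ℂ} (hg : Measurable g) :
    eLpNorm (fun ξ => (𝓕 (complexify f) : L2C) ξ - g ξ) 2 volume ≤
      ‖f - f₀‖ₑ + eLpNorm (fun ξ => (𝓕 (complexify f₀) : L2C) ξ - g ξ) 2 volume := by
  have hn : ‖f - f₀‖ₑ = eLpNorm (𝓕 (complexify (f - f₀)) : L2C) 2 volume := by
    rw [← Lp.enorm_def, ← ofReal_norm, ← ofReal_norm, Lp.norm_fourier_eq, norm_complexify]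
  rw [hn]
  have hs : (𝓕 (complexify (f - f₀)) : L2C) = 𝓕 (complexify f) - 𝓕 (complexify f₀) := by
    rw [complexify_sub, fourier_sub_L2C]
  rw [hs]
  generalize (𝓕 (complexify f) : L2C) = F
  generalize (𝓕 (complexify f₀) : L2C) = F₀
  have he : (fun ξ => F ξ - g ξ) =ᵐ[volume] (F - F₀ : L2C) + fun ξ => F₀ ξ - g ξ := by
    filter_upwards [Lp.coeFn_sub F F₀] with ξ h
    rw [Pi.add_apply, h, Pi.sub_apply]
    ring
  rw [eLpNorm_congr_ae he]
  exact eLpNorm_add_le (Lp.aestronglyMeasurable _)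
    ((Lp.aestronglyMeasurable _).sub hg.aestronglyMeasurable) (by norm_num)

/-- If two solutions agree on `[0, a]`, then they agree a little longer: on a short interval after
`a`, the square of the space-time `L²` norm of their difference is finite and at most half of
itself. -/
lemma exists_gt_forall_eq {T : ℝ} {θ θ' : ℝ → L2} (hθ : Continuous θ) (hθ' : Continuous θ')
    (hF : ∀ t ∈ Icc 0 T, (𝓕 (complexify (θ t - θ' t)) : L2C) =ᵐ[volume]
      fun ξ => duhamelHat θ' t ξ - duhamelHat θ t ξ)
    {a : ℝ} (ha : a ∈ Ico 0 T) (heq : ∀ s ∈ Icc 0 a, θ s = θ' s) :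
    ∃ b > a, ∀ t ∈ Icc a b, θ t = θ' t := by
  -- Approximate `𝓕 (θ a + θ' a)` in `L²` by a continuous function with compact support. Near `a`
  -- the remainder then has norm at most `2 / 256`, and `2048 * (2 / 256) ^ 2 ≤ 1 / 4`.
  obtain ⟨g, hgc, hgε, hgcont, -⟩ :=
    (Lp.memLp (𝓕 (complexify (θ a + θ' a)) : L2C)).exists_hasCompactSupport_eLpNorm_sub_le
      (by norm_num) (ε := ENNReal.ofReal (1 / 256)) (by simp)
  have hgm : Measurable g := hgcont.measurable
  have hG : ∫⁻ ξ, ‖g ξ‖ₑ ≠ ∞ := (hgcont.integrable_of_hasCompactSupport hgc).2.ne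
  set G : ℝ := (∫⁻ ξ, ‖g ξ‖ₑ).toReal with hGdef
  obtain ⟨δ₁, hδ₁, hclose⟩ := Metric.continuousAt_iff.1
    ((hθ.add hθ').continuousAt (x := a)) (1 / 256) (by norm_num)
  set δ : ℝ := min (min (δ₁ / 2) (T - a)) (1 / (2048 * (G ^ 2 + 1))) with hδdef
  have hδ : 0 < δ := by
    refine lt_min (lt_min (by linarith) (by linarith [ha.2])) (by positivity)
  have hδ1 : δ ≤ δ₁ / 2 := (min_le_left _ _).trans (min_le_left _ _)
  have hδT : δ ≤ T - a := (min_le_left _ _).trans (min_le_right _ _)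
  have hδG : δ ≤ 1 / (2048 * (G ^ 2 + 1)) := min_le_right _ _
  set m : ℝ → Plane → ℝ≥0∞ := fun s ξ => ‖divFluxHat (θ s) ξ - divFluxHat (θ' s) ξ‖ₑ with hm
  have hcont : ∀ {θ : ℝ → L2}, Continuous θ →
      Continuous fun p : ℝ × Plane => divFluxHat (θ p.1) p.2 := fun hθ =>
    continuous_divFluxHat.comp₂ (hθ.comp continuous_fst) continuous_snd
  have hmm : Measurable fun p : ℝ × Plane => m p.1 p.2 :=
    ((hcont hθ).sub (hcont hθ')).measurable.enorm
  have hzero : ∀ s ∈ Icc 0 a, ∀ ξ, m s ξ = 0 := by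
    intro s hs ξ
    simp [hm, heq s hs]
  have hmax := lintegral_sq_duhamel_le hmm (a := a) (δ := δ)
    (E := fun t ξ => ‖(𝓕 (complexify (θ t - θ' t)) : L2C) ξ‖ₑ) ?_
  swap
  · intro t ht
    have ht0 : 0 ≤ t := ha.1.trans ht.1
    filter_upwards [hF t ⟨ht0, by linarith [ht.2]⟩] with ξ hξ
    have hi : ∀ {θ : ℝ → L2}, Continuous θ → IntervalIntegrable
        (fun s => (heatSymbol (t - s) ξ : ℂ) * divFluxHat (θ s) ξ) volume 0 t := fun hθ =>
      ((continuous_duhamel_integrand hθ t).comp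
        (by fun_prop : Continuous fun s : ℝ => (s, ξ))).intervalIntegrable 0 t
    rw [hξ, duhamelHat, duhamelHat, ← intervalIntegral.integral_sub (hi hθ') (hi hθ),
      intervalIntegral.integral_of_le ht0]
    refine (enorm_integral_le_lintegral_enorm _).trans ?_
    have hpt : ∀ s, ‖(heatSymbol (t - s) ξ : ℂ) * divFluxHat (θ' s) ξ -
        (heatSymbol (t - s) ξ : ℂ) * divFluxHat (θ s) ξ‖ₑ =
        m s ξ * ENNReal.ofReal (heatSymbol (t - s) ξ) := by
      intro s
      rw [← mul_sub, enorm_mul, enorm_sub_rev, mul_comm, ← ofReal_norm (heatSymbol (t - s) ξ : ℂ),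
        Complex.norm_real, Real.norm_of_nonneg (heatSymbol_pos _ _).le]
    simp_rw [hpt]
    rw [← lintegral_indicator measurableSet_Ioc, ← lintegral_indicator measurableSet_Icc]
    refine lintegral_mono fun s => ?_
    by_cases hs : s ∈ Ioc 0 t
    · rw [indicator_of_mem hs]
      rcases le_total s a with hsa | hsa
      · rw [hzero s ⟨hs.1.le, hsa⟩ ξ, zero_mul]
        exact zero_le
      · rw [indicator_of_mem (show s ∈ Icc a t from ⟨hsa, hs.2⟩)]
    · rw [indicator_of_notMem hs]
      exact zero_le
  simp_rw [lintegral_sq_enorm_fourier_complexify] at hmax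
  have hG2 : 512 * ENNReal.ofReal δ * (∫⁻ ξ, ‖g ξ‖ₑ) ^ 2 ≤ ENNReal.ofReal (1 / 4) := by
    rw [← ENNReal.ofReal_toReal hG, ← hGdef, ← ENNReal.ofReal_pow ENNReal.toReal_nonneg,
      ← ENNReal.ofReal_ofNat, ← ENNReal.ofReal_mul (by norm_num),
      ← ENNReal.ofReal_mul (by positivity)]
    refine ENNReal.ofReal_le_ofReal ?_
    rw [le_div_iff₀ (by positivity)] at hδG
    nlinarith [sq_nonneg G]
  have hstep : ∀ s ∈ Icc a (a + δ), ∫⁻ ξ, heatMass δ ξ ^ 2 * m s ξ ^ 2 ≤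
      2⁻¹ * ‖θ s - θ' s‖ₑ ^ 2 := by
    intro s hs
    refine (lintegral_sq_heatMass_mul_le δ (θ s) (θ' s) hgm).trans ?_
    gcongr
    have h1 : ‖(θ s + θ' s) - (θ a + θ' a)‖ₑ ≤ ENNReal.ofReal (1 / 256) := by
      rw [← ofReal_norm, ← dist_eq_norm]
      refine ENNReal.ofReal_le_ofReal (hclose ?_).le
      rw [Real.dist_eq, abs_of_nonneg (by linarith [hs.1])]
      linarith [hs.2]
    have h2 := (eLpNorm_fourier_sub_le (θ s + θ' s) (θ a + θ' a) hgm).trans (add_le_add h1 hgε)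
    calc _ ≤ 2048 * (ENNReal.ofReal (1 / 256) + ENNReal.ofReal (1 / 256)) ^ 2 +
          ENNReal.ofReal (1 / 4) := by gcongr
      _ ≤ 2⁻¹ := by
        rw [← ENNReal.ofReal_add (by norm_num) (by norm_num), ← ENNReal.ofReal_pow (by norm_num),
          ← ENNReal.ofReal_ofNat, ← ENNReal.ofReal_mul (by norm_num),
          ← ENNReal.ofReal_add (by norm_num) (by norm_num), ← ENNReal.ofReal_ofNat,
          ← ENNReal.ofReal_inv_of_pos (by norm_num)]
        exact ENNReal.ofReal_le_ofReal (by norm_num)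
  have hwc : Continuous fun s => ‖θ s - θ' s‖ₑ ^ 2 :=
    (ENNReal.continuous_pow 2).comp (hθ.sub hθ').enorm
  set X := ∫⁻ t in Icc a (a + δ), ‖θ t - θ' t‖ₑ ^ 2 with hX
  have hXle : X ≤ 2⁻¹ * X := by
    refine hmax.trans ((setLIntegral_mono (hwc.measurable.const_mul _) hstep).trans_eq ?_)
    rw [lintegral_const_mul _ hwc.measurable]
  have hXfin : X ≠ ∞ := by
    obtain ⟨M, hM⟩ := (isCompact_Icc (a := a) (b := a + δ)).exists_bound_of_continuousOn
      (f := fun s => ‖θ s - θ' s‖ ^ 2) (by fun_prop)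
    have hle : X ≤ ∫⁻ _ in Icc a (a + δ), ENNReal.ofReal M := by
      refine setLIntegral_mono measurable_const fun s hs => ?_
      rw [← ofReal_norm, ← ENNReal.ofReal_pow (norm_nonneg _)]
      exact ENNReal.ofReal_le_ofReal ((Real.le_norm_self _).trans (hM s hs))
    refine ne_top_of_le_ne_top ?_ hle
    rw [setLIntegral_const, Real.volume_Icc]
    exact ENNReal.mul_ne_top ENNReal.ofReal_ne_top ENNReal.ofReal_ne_top
  have hX0 : X = 0 := by
    by_contra h0
    have := ENNReal.half_lt_self h0 hXfin
    rw [ENNReal.div_eq_inv_mul] at this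
    exact absurd hXle (not_le.2 this)
  have hae : (fun s => ‖θ s - θ' s‖ₑ ^ 2) =ᵐ[volume.restrict (Icc a (a + δ))] fun _ => 0 :=
    (lintegral_eq_zero_iff hwc.measurable).1 hX0
  refine ⟨a + δ, by linarith, fun t ht => ?_⟩
  have h0 := Measure.eqOn_Icc_of_ae_eq volume (by linarith : a ≠ a + δ) hae hwc.continuousOn
    continuousOn_const ht
  simpa [sub_eq_zero] using h0

/-- A mild solution attains its datum at time `0`. -/
lemma IsMildSolution.apply_zero {T : ℝ} (hT : 0 ≤ T) {θ₀ : L2} {θ : ℝ → L2}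
    (h : IsMildSolution T θ₀ θ) : θ 0 = θ₀ := by
  refine Lp.ext ?_
  refine ae_eq_of_integral_contDiff_smul_eq ((Lp.memLp _).locallyIntegrable (by norm_num))
    ((Lp.memLp _).locallyIntegrable (by norm_num)) fun g hg hgc => ?_
  have h1 := h.duhamel 0 ⟨le_rfl, hT⟩ (hgc.toSchwartzMap hg)
  simpa [heat, mul_comm] using h1

/-- Extending a mild solution by constants outside `[0, T]` makes it continuous on the line. -/
lemma IsMildSolution.projIcc {T : ℝ} (hT : 0 ≤ T) {θ₀ : L2} {θ : ℝ → L2}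
    (h : IsMildSolution T θ₀ θ) : IsMildSolution T θ₀ (fun t => θ (Set.projIcc 0 T hT t)) := by
  have he : ∀ s ∈ Icc 0 T, θ (Set.projIcc 0 T hT s) = θ s := fun s hs => by
    rw [projIcc_of_mem hT hs]
  refine ⟨h.continuousOn.congr he, fun t ht φ => ?_⟩
  simp only [he t ht]
  rw [h.duhamel t ht φ]
  congr 1
  refine intervalIntegral.integral_congr fun s hs => ?_
  rw [uIcc_of_le ht.1] at hs
  simp only [he s ⟨hs.1, hs.2.trans ht.2⟩]

lemma eq_of_continuous {T : ℝ} (hT : 0 ≤ T) {θ₀ : L2} {θ θ' : ℝ → L2} (h : IsMildSolution T θ₀ θ)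
    (h' : IsMildSolution T θ₀ θ') (hθ : Continuous θ) (hθ' : Continuous θ') :
    ∀ t ∈ Icc 0 T, θ t = θ' t := by
  have hF := fun t (ht : t ∈ Icc 0 T) => fourier_sub_ae_eq h h' hθ hθ' ht
  have h0 : θ 0 = θ' 0 := (h.apply_zero hT).trans (h'.apply_zero hT).symm
  -- The set of `t` with `θ = θ'` on `[0, t]`; the minimum makes its closedness evident.
  set S : Set ℝ := {t | ∀ r, 0 ≤ r → θ (min r t) = θ' (min r t)} with hS
  have hclosed : IsClosed S := by
    simp only [hS, ofPred_forall]
    exact isClosed_iInter fun r => isClosed_iInter fun _ =>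
      isClosed_eq (by fun_prop) (by fun_prop)
  have hsub : Icc 0 T ⊆ S := by
    refine (hclosed.inter isClosed_Icc).Icc_subset_of_forall_exists_gt ?_ ?_
    · intro r hr
      rw [min_eq_right hr]
      exact h0
    · rintro a ⟨haS, ha⟩ y hy
      obtain ⟨b, hb, hab⟩ := exists_gt_forall_eq hθ hθ' hF ha fun s hs => by
        have := haS s hs.1
        rwa [min_eq_left hs.2] at this
      refine ⟨min b y, fun r hr => ?_, lt_min hb hy, min_le_right _ _⟩
      rcases le_total (min r (min b y)) a with hle | hle
      · have := haS (min r (min b y))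
          (le_min hr (le_min (ha.1.trans hb.le) (ha.1.trans (le_of_lt hy))))
        rwa [min_eq_left hle] at this
      · exact hab _ ⟨hle, (min_le_right _ _).trans (min_le_left _ _)⟩
  intro t ht
  have := hsub ht t ht.1
  rwa [min_self] at this

end SQG

theorem theorem1 (T : ℝ) (hT : 0 < T) (θ₀ θ₀' : SQG.L2) (θ θ' : ℝ → SQG.L2)
    (hθ : SQG.IsMildSolution T θ₀ θ) (hθ' : SQG.IsMildSolution T θ₀' θ')
    (h0 : θ 0 = θ' 0) :
    ∀ t ∈ Set.Icc 0 T, θ t = θ' t := by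
  obtain rfl : θ₀ = θ₀' := by
    rw [← hθ.apply_zero hT.le, ← hθ'.apply_zero hT.le, h0]
  intro t ht
  have h := SQG.eq_of_continuous hT.le (hθ.projIcc hT.le) (hθ'.projIcc hT.le)
    ((continuousOn_iff_continuous_domRestrict.1 hθ.continuousOn).comp continuous_projIcc)
    ((continuousOn_iff_continuous_domRestrict.1 hθ'.continuousOn).comp continuous_projIcc) t ht
  simpa only [projIcc_of_mem hT.le ht] using h
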